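/- Consider the linear model $y = X\beta^* + \xi$ with $n\ge 1$ observations and a fixed design $X \in \mathbb{R}^{n\times p}$ whose columns satisfy $\|X_j\|_2 = n^{1/2}$. Write $S^* = \mathrm{supp}(\beta^*)$ and let $1 \le s^* < p$. **Iteration.** Hard thresholding pursuit (HTP) with model size $s$, started at $\beta^0$ with $S^0=\mathrm{supp}(\beta^0)$, computes for $t=0,1,2,\dots$ $$S^{t+1} = \mathrm{supp}\Big(\mathcal{T}_s\big(\beta^t + X^\top(y - X\beta^t)/n\big)\Big),\qquad \beta^{t+1} \in \arg\min\{\|y - X\beta\|_2 : \mathrm{supp}(\beta) \subseteq S^{t+1}\},$$ where $\mathcal{T}_s$ keeps $s$ entries of largest modulus (ties broken arbitrarily) and sets all others to zero. **Assumptions.** Let $0<\epsilon<1$ and $C_0, C_{\mathrm{init}}>0$. 1. The errors $\xi_1,\dots,\xi_n$ are i.i.d. with mean zero and sub-Gaussian with scale parameter $\sigma^2$, $\sigma>0$; that is, $\mathbb{E}\,e^{\theta \xi_i} \le e^{\sigma^2\theta^2/2}$ for all $\theta \in \mathbb{R}$. 2. $X$ satisfies the restricted isometry property of order $3s$ with a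 constant $\delta \in (0,1)$, i.e. $1-\delta \le \|X_S u\|_2^2/(n\|u\|_2^2) \le 1+\delta$ for all $S\subset\{1,\dots,p\}$ with $|S| \le 3s$ and all $u \in \mathbb{R}^{|S|}\setminus\{0\}$; moreover $\delta < \min(\epsilon^2, 0.005)$. 3. $n \ge C_0\, s_{\max}\log(p/s_{\max})$ for some $s_{\max}\ge s$. 4. $\lambda \ge (1+3\epsilon)\,\sigma\{2\log(p/s^*)/n\}^{1/2}$, and $\Omega^p_{s^*,\lambda} = \{\beta^* \in \mathbb{R}^p : \|\beta^*\|_0 = s^*,\ \min_{i \in S^*}|\beta^*_i| \ge \lambda\}$. 5. The initial estimator $\beta^0$, which may be random and depend on the data, satisfies almost surely $\|\beta^0 - \beta^*\|_2 \le C_{\mathrm{init}}\,\sigma\{s^*\log(p/s^*)/n\}^{1/2}$ and $\|\beta^0\|_0 \le s$. 6. $s$ is an integer with $s^* \le s \le s^* + s^*/\log(p/s^*)$. **Conclusion.** There are constants $K, C_{2}, C_{3}>0$ depending only on $\epsilon$, and a constant $C_{1}>0$ depending only on $\epsilon$, $C_0$ and $C_{\mathrm{init}}$, such that for every integer $t \ge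 \log\{C_{1}^2\log(p/s^*)\}$, $t\ge 0$, $$\sup_{\beta^* \in \Omega^p_{s^*,\lambda}} \Pr\left\{\frac{|S^t \,\Delta\, S^*|}{s^*} \ge \frac{K}{\log(p/s^*)}\right\} \le \exp(-C_{2}s^*) + \Big(\frac{s^*}{p}\Big)^{C_{3}}.$$ In particular the type-I error $|S^t\setminus S^*|$ and the type-II error $|S^*\setminus S^t|$ are $o(s^*)$: there is a function $r$, depending only on $\epsilon$, with $r(x)\to 0$ as $x\to\infty$, such that, uniformly over $\beta^*\in\Omega^p_{s^*,\lambda}$, with probability at least $1-\exp(-C_{2}s^*) - (s^*/p)^{C_{3}}$ both errors are smaller than $r(p/s^*)\,s^*$. -/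

import Mathlib

open MeasureTheory ProbabilityTheory Filter Topology
open scoped Matrix

noncomputable section

namespace HTP

/-- Euclidean norm of a finite real vector. -/
def l2norm {ι : Type*} [Fintype ι] (v : ι → ℝ) : ℝ := ‖WithLp.toLp 2 v‖

/-- Support of a coefficient vector. -/
def supp {p : ℕ} (β : Fin p → ℝ) : Finset (Fin p) := {i | β i ≠ 0}

/-- Restricted isometry property of order `k` with constant `δ`. A vector indexed by `S` is
written as a vector on all the coordinates that vanishes off `S`. -/
def RIP {n p : ℕ} (X : Matrix (Fin n) (Fin p) ℝ) (k : ℕ) (δ : ℝ) : Prop :=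
  0 < δ ∧ δ < 1 ∧
    ∀ S : Finset (Fin p), S.card ≤ k → ∀ u : Fin p → ℝ, u ≠ 0 → (∀ i, i ∉ S → u i = 0) →
      1 - δ ≤ l2norm (X *ᵥ u) ^ 2 / (n * l2norm u ^ 2) ∧
        l2norm (X *ᵥ u) ^ 2 / (n * l2norm u ^ 2) ≤ 1 + δ

/-- I.i.d. centred errors, sub-Gaussian with scale parameter (variance proxy) `σ ^ 2`:
`E exp (θ ξᵢ) ≤ exp (σ² θ² / 2)` for all real `θ`. -/
structure SubGaussianErrors {Ω : Type*} [MeasurableSpace Ω] (μ : Measure Ω) {n : ℕ}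
    (ξ : Fin n → Ω → ℝ) (σ : ℝ) : Prop where
  measurable : ∀ i, Measurable (ξ i)
  indep : iIndepFun ξ μ
  identDistrib : ∀ i j, IdentDistrib (ξ i) (ξ j) μ μ
  mean_zero : ∀ i, ∫ ω, ξ i ω ∂μ = 0
  subgaussian : ∀ i, HasSubgaussianMGF (ξ i) ⟨σ ^ 2, sq_nonneg σ⟩ μ

/-- Coefficient vectors with exactly `k` nonzero entries, each of modulus at least `lam`. -/
def betaMinClass (p k : ℕ) (lam : ℝ) : Set (Fin p → ℝ) :=
  {β | (supp β).card = k ∧ ∀ i ∈ supp β, lam ≤ |β i|}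

/-- `w` is obtained from `v` by keeping `s` entries of largest modulus (all of them if `s`
exceeds the length) and setting the others to zero. Ties may be broken in any way. -/
def IsHardThreshold {p : ℕ} (s : ℕ) (v w : Fin p → ℝ) : Prop :=
  ∃ T : Finset (Fin p), T.card = min s p ∧ (∀ i ∈ T, ∀ j, j ∉ T → |v j| ≤ |v i|) ∧
    ∀ i, w i = if i ∈ T then v i else 0

/-- `b` minimizes `‖y - X b‖₂` among the vectors supported in `S`. -/
def IsLeastSquaresOn {n p : ℕ} (X : Matrix (Fin n) (Fin p) ℝ) (y : Fin n → ℝ)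
    (S : Finset (Fin p)) (b : Fin p → ℝ) : Prop :=
  supp b ⊆ S ∧ ∀ b' : Fin p → ℝ, supp b' ⊆ S → l2norm (y - X *ᵥ b) ≤ l2norm (y - X *ᵥ b')

/-- `(b t, S t)`, `t = 0, 1, …`, are the iterates of hard thresholding pursuit with model size
`s`, started at `b 0`. -/
structure IsHTPPath {n p : ℕ} (X : Matrix (Fin n) (Fin p) ℝ) (y : Fin n → ℝ) (s : ℕ)
    (b : ℕ → Fin p → ℝ) (S : ℕ → Finset (Fin p)) : Prop where
  init : S 0 = supp (b 0)
  threshold : ∀ t, ∃ w, IsHardThreshold s (b t + (n : ℝ)⁻¹ • (Xᵀ *ᵥ (y - X *ᵥ b t))) w ∧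
    S (t + 1) = supp w
  debias : ∀ t, IsLeastSquaresOn X y (S (t + 1)) (b (t + 1))

end HTP

end

namespace HTP

/-! Write `L = log (p / s*)`, `v = σ² / n`, `z² = 2 L v`, `k = s*`. With `e = b t - β`, the vector
that is thresholded equals `β + Δ + Ξ`, where `Δ = (I - XᵀX/n) e` is small on few coordinates by
restricted isometry, and `Ξ = Xᵀξ/n` has coordinates with variance proxy `v`.

A missed coefficient has modulus at least `(1 + 3ε) z`. If thresholding discards it, it can be
paired injectively with a false selection whose entry is at least as large. Granting noise `ε z` to
the first and `(1 + ε) z` to the second leaves a gap `ε z`, which only `Δ` and the excess of the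
noise over these levels can fill. Hence the energy of the missed coefficients is at most a small
multiple of `‖e‖²` plus the excess energy (`sum_missed_sq_le`, `IsHTPPath.missedEnergy_succ_le`).
Least squares in turn bounds `‖e‖²` by the missed energy plus `O(v k)` (`IsHTPPath.error_succ_le`),
so the missed energy contracts geometrically down to `O(v k)`, in about `log L` steps from an
initial error `O(L v k)`. Each miss costs at least `z² = 2 L v`, so `O(k / L)` misses remain; the
bound on `s` then limits the false selections.

Two noise events suffice. The noise energy on the true support is `O(v k)` outside probability `exp
(-k)`, by Gaussian decoupling. The excess energy is below `v k` outside probability `exp (-ε² L) =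
(s*/p)^(ε²)`, by Markov: the factor `p` in its mean is absorbed by `p exp (-L) = k`. -/

lemma zero_le_dotProduct_self {ι : Type*} [Fintype ι] (v : ι → ℝ) : 0 ≤ v ⬝ᵥ v :=
  Finset.sum_nonneg fun _ _ => mul_self_nonneg _

/-! ### Concentration -/

section Concentration

universe u

variable {Ω : Type*} [MeasurableSpace Ω] {μ : Measure Ω}

lemma integral_exp_dotProduct_gaussian {ι : Type*} [Fintype ι] (v : ι → ℝ) :
    Integrable (fun g : ι → ℝ => Real.exp (g ⬝ᵥ v)) (Measure.pi fun _ : ι => gaussianReal 0 1) ∧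
    ∫ g : ι → ℝ, Real.exp (g ⬝ᵥ v) ∂(Measure.pi fun _ : ι => gaussianReal 0 1) =
      Real.exp ((v ⬝ᵥ v) / 2) := by
  have h (g : ι → ℝ) : Real.exp (g ⬝ᵥ v) = ∏ i, Real.exp (v i * g i) := by
    rw [← Real.exp_sum]
    simp [dotProduct, mul_comm]
  simp only [h]
  constructor
  · exact Integrable.fintype_prod (f := fun i x => Real.exp (v i * x))
      fun i => integrable_exp_mul_gaussianReal (v i)
  · rw [integral_fintype_prod_eq_prod (fun i x => Real.exp (v i * x))]
    have hm (i : ι) : ∫ x, Real.exp (v i * x) ∂gaussianReal 0 1 = Real.exp (v i * v i / 2) := by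
      have := congrFun (mgf_id_gaussianReal (μ := 0) (v := 1)) (v i)
      simpa [mgf, sq] using this
    simp only [hm]
    rw [← Real.exp_sum, dotProduct, Finset.sum_div]

lemma integral_exp_sq_gaussian {ι : Type*} [Fintype ι] {c : ℝ}
    (hc : Integrable (fun x : ℝ => Real.exp (c * ‖x‖ ^ 2)) (gaussianReal 0 1)) :
    Integrable (fun g : ι → ℝ => Real.exp (c * (g ⬝ᵥ g)))
      (Measure.pi fun _ : ι => gaussianReal 0 1) ∧
    ∫ g : ι → ℝ, Real.exp (c * (g ⬝ᵥ g)) ∂(Measure.pi fun _ : ι => gaussianReal 0 1) =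
      (∫ x, Real.exp (c * ‖x‖ ^ 2) ∂gaussianReal 0 1) ^ Fintype.card ι := by
  have h (g : ι → ℝ) : Real.exp (c * (g ⬝ᵥ g)) = ∏ i, Real.exp (c * ‖g i‖ ^ 2) := by
    rw [← Real.exp_sum]
    simp [dotProduct, Finset.mul_sum, sq]
  simp only [h]
  exact ⟨Integrable.fintype_prod (f := fun _ x => Real.exp (c * ‖x‖ ^ 2)) fun _ => hc,
    integral_fintype_prod_eq_pow (fun x : ℝ => Real.exp (c * ‖x‖ ^ 2))⟩

/-- The squared norm of a sub-Gaussian vector in dimension `d` with variance proxy `κ` exceeds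
a universal multiple of `κ d` with probability at most `exp (-d)`. -/
lemma exists_measure_dotProduct_self_ge_le : ∃ A : ℝ, 0 < A ∧
    ∀ {Ω : Type u} [MeasurableSpace Ω] {μ : Measure Ω} [IsProbabilityMeasure μ]
      {ι : Type} [Fintype ι] {V : Ω → ι → ℝ} {κ : ℝ}, 0 < κ → Measurable V →
      (∀ g : ι → ℝ, Integrable (fun ω => Real.exp (g ⬝ᵥ V ω)) μ ∧
        ∫ ω, Real.exp (g ⬝ᵥ V ω) ∂μ ≤ Real.exp (κ * (g ⬝ᵥ g) / 2)) →
      μ {ω | A * κ * Fintype.card ι ≤ V ω ⬝ᵥ V ω} ≤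
        ENNReal.ofReal (Real.exp (-Fintype.card ι)) := by
  -- Fernique's theorem supplies a universal `c`, so `M` and the final constant depend on neither
  -- the law of `V` nor the dimension.
  obtain ⟨c, hc0, hc⟩ := IsGaussian.exists_integrable_exp_sq (gaussianReal 0 1)
  set M := ∫ x, Real.exp (c * ‖x‖ ^ 2) ∂gaussianReal 0 1 with hM
  have hM1 : 1 ≤ M := by
    have : ∫ _ : ℝ, (1 : ℝ) ∂gaussianReal 0 1 ≤ M :=
      integral_mono (integrable_const _) hc fun x => Real.one_le_exp (by positivity)
    simpa using this
  refine ⟨(Real.log M + 1) / c, by have := Real.log_nonneg hM1; positivity, ?_⟩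
  intro Ω _ μ _ ι _ V κ hκ hV hmgf
  set γ := Measure.pi fun _ : ι => gaussianReal 0 1
  -- Decoupling: for a standard Gaussian `g`, the mean of `exp (t g·V)` over `g` is `exp (t² ‖V‖² /
  -- 2)`, here `exp (c ‖V‖² / κ)`. Averaging over `V` first instead gives at most `exp (c ‖g‖²)`,
  -- whose mean is `M ^ d`.
  set t := √(2 * c / κ)
  have ht : t ^ 2 = 2 * c / κ := Real.sq_sqrt (by positivity)
  have hmeas : Measurable fun q : Ω × (ι → ℝ) => ENNReal.ofReal (Real.exp (q.2 ⬝ᵥ (t • V q.1))) := by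
    unfold dotProduct
    simp only [Pi.smul_apply]
    fun_prop
  have key : ∫⁻ ω, ENNReal.ofReal (Real.exp (c / κ * (V ω ⬝ᵥ V ω))) ∂μ ≤
      ENNReal.ofReal (M ^ Fintype.card ι) := by
    calc _ = ∫⁻ ω, ∫⁻ g, ENNReal.ofReal (Real.exp (g ⬝ᵥ (t • V ω))) ∂γ ∂μ := by
          refine lintegral_congr fun ω => ?_
          obtain ⟨hi, he⟩ := integral_exp_dotProduct_gaussian (t • V ω)
          rw [← ofReal_integral_eq_lintegral_ofReal hi (ae_of_all _ fun _ => (Real.exp_pos _).le),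
            he]
          congr 2
          rw [smul_dotProduct, dotProduct_smul, smul_smul, smul_eq_mul, ← sq, ht]
          ring
      _ = ∫⁻ g, ∫⁻ ω, ENNReal.ofReal (Real.exp (g ⬝ᵥ (t • V ω))) ∂μ ∂γ :=
          lintegral_lintegral_swap hmeas.aemeasurable
      _ ≤ ∫⁻ g, ENNReal.ofReal (Real.exp (c * (g ⬝ᵥ g))) ∂γ := by
          refine lintegral_mono fun g => ?_
          obtain ⟨hi, he⟩ := hmgf (t • g)
          have hs (ω : Ω) : g ⬝ᵥ (t • V ω) = (t • g) ⬝ᵥ V ω := by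
            rw [smul_dotProduct, dotProduct_smul]
          simp only [hs]
          rw [← ofReal_integral_eq_lintegral_ofReal hi (ae_of_all _ fun _ => (Real.exp_pos _).le)]
          refine ENNReal.ofReal_le_ofReal (he.trans_eq ?_)
          rw [smul_dotProduct, dotProduct_smul, smul_smul, smul_eq_mul, ← sq, ht]
          congr 1
          field_simp
      _ = _ := by
          obtain ⟨hi, he⟩ := integral_exp_sq_gaussian (ι := ι) hc
          rw [← ofReal_integral_eq_lintegral_ofReal hi (ae_of_all _ fun _ => (Real.exp_pos _).le),
            he]
  set d := Fintype.card ι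
  have hmV : Measurable fun ω => ENNReal.ofReal (Real.exp (c / κ * (V ω ⬝ᵥ V ω))) := by
    unfold dotProduct
    fun_prop
  -- Markov at this level: `log M` cancels `M ^ d` and the extra `1` leaves `exp (-d)`.
  have hpos : 0 < Real.exp ((Real.log M + 1) * d) := Real.exp_pos _
  calc _ ≤ μ {ω | ENNReal.ofReal (Real.exp ((Real.log M + 1) * d)) ≤
          ENNReal.ofReal (Real.exp (c / κ * (V ω ⬝ᵥ V ω)))} := by
        refine measure_mono fun ω hω => ENNReal.ofReal_le_ofReal (Real.exp_le_exp.2 ?_)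
        have h1 := mul_le_mul_of_nonneg_left (Set.mem_ofPred_eq ▸ hω) (by positivity : 0 ≤ c / κ)
        refine le_trans (le_of_eq ?_) h1
        field_simp
    _ ≤ (∫⁻ ω, ENNReal.ofReal (Real.exp (c / κ * (V ω ⬝ᵥ V ω))) ∂μ) /
          ENNReal.ofReal (Real.exp ((Real.log M + 1) * d)) :=
        meas_ge_le_lintegral_div hmV.aemeasurable (by simpa using hpos) ENNReal.ofReal_ne_top
    _ ≤ ENNReal.ofReal (M ^ d) / ENNReal.ofReal (Real.exp ((Real.log M + 1) * d)) := by gcongr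
    _ = _ := by
        rw [← ENNReal.ofReal_div_of_pos hpos]
        congr 1
        have : M ^ d = Real.exp (Real.log M * d) := by
          rw [mul_comm, Real.exp_nat_mul, Real.exp_log (by linarith)]
        rw [this, ← Real.exp_sub]
        congr 1
        ring

lemma SubGaussianErrors.hasSubgaussianMGF_dotProduct {n : ℕ} {ξ : Fin n → Ω → ℝ} {σ : ℝ}
    (h : SubGaussianErrors μ ξ σ) (a : Fin n → ℝ) :
    HasSubgaussianMGF (fun ω => a ⬝ᵥ fun i => ξ i ω)
      (⟨(a ⬝ᵥ a) * σ ^ 2, mul_nonneg (zero_le_dotProduct_self a) (sq_nonneg σ)⟩) μ := by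
  have hi : iIndepFun (fun i ω => a i * ξ i ω) μ :=
    h.indep.comp (fun i x => a i * x) fun i => by fun_prop
  have := HasSubgaussianMGF.sum_of_iIndepFun hi (s := Finset.univ)
    fun i _ => (h.subgaussian i).const_mul (a i)
  have hc : (⟨(a ⬝ᵥ a) * σ ^ 2, mul_nonneg (zero_le_dotProduct_self a) (sq_nonneg σ)⟩ : NNReal) =
      ∑ i, ⟨a i ^ 2, sq_nonneg _⟩ * ⟨σ ^ 2, sq_nonneg σ⟩ := by
    refine NNReal.eq (Eq.trans ?_ (NNReal.coe_sum _ _).symm)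
    change (∑ i, a i * a i) * σ ^ 2 = ∑ i, a i ^ 2 * σ ^ 2
    rw [Finset.sum_mul]
    simp only [sq]
  rw [hc]
  exact this

lemma SubGaussianErrors.integral_exp_dotProduct_le {n : ℕ} {ξ : Fin n → Ω → ℝ} {σ : ℝ}
    (h : SubGaussianErrors μ ξ σ) (a : Fin n → ℝ) :
    Integrable (fun ω => Real.exp (a ⬝ᵥ fun i => ξ i ω)) μ ∧
    ∫ ω, Real.exp (a ⬝ᵥ fun i => ξ i ω) ∂μ ≤ Real.exp (σ ^ 2 * (a ⬝ᵥ a) / 2) := by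
  have hs := h.hasSubgaussianMGF_dotProduct a
  refine ⟨by simpa using hs.integrable_exp_mul 1, ?_⟩
  have := hs.mgf_le 1
  simp only [mgf, one_mul, one_pow, mul_one] at this
  refine this.trans_eq ?_
  congr 1
  change (a ⬝ᵥ a) * σ ^ 2 / 2 = _
  ring

/-- The excess of `|x|` over the level `a`. -/
noncomputable def excess (a x : ℝ) : ℝ := max (|x| - a) 0

lemma excess_nonneg (a x : ℝ) : 0 ≤ excess a x := le_max_right _ _

lemma abs_le_add_excess (a x : ℝ) : |x| ≤ a + excess a x := by
  have := le_max_left (|x| - a) 0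
  unfold excess
  linarith

/-- Chernoff's argument for a second moment: `y² / 2 ≤ exp y` for `y ≥ 0`, applied to `θ (|x| - a)`.
The majorant is a combination of exponentials, integrable without any discussion of `excess`. -/
lemma excess_sq_le {θ : ℝ} (hθ : 0 < θ) (a x : ℝ) :
    excess a x ^ 2 ≤ 2 / θ ^ 2 * Real.exp (-(θ * a)) * (Real.exp (θ * x) + Real.exp (-θ * x)) := by
  have h1 : (θ * excess a x) ^ 2 / 2 ≤ Real.exp (θ * (|x| - a)) := by
    rcases le_total (|x| - a) 0 with h | h
    · simp [excess, max_eq_right h, (Real.exp_pos _).le]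
    · rw [excess, max_eq_left h]
      have := Real.quadratic_le_exp_of_nonneg (mul_nonneg hθ.le h)
      nlinarith [mul_nonneg hθ.le h]
  have h2 : Real.exp (θ * |x|) ≤ Real.exp (θ * x) + Real.exp (-θ * x) := by
    rcases abs_cases x with ⟨h, -⟩ | ⟨h, -⟩ <;> rw [h]
    · linarith [Real.exp_pos (-θ * x)]
    · rw [mul_neg, ← neg_mul]
      linarith [Real.exp_pos (θ * x)]
  have h3 : Real.exp (θ * (|x| - a)) = Real.exp (-(θ * a)) * Real.exp (θ * |x|) := by
    rw [← Real.exp_add]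
    congr 1
    ring
  rw [h3] at h1
  have h4 := h1.trans (mul_le_mul_of_nonneg_left h2 (Real.exp_pos (-(θ * a))).le)
  have : excess a x ^ 2 = 2 / θ ^ 2 * ((θ * excess a x) ^ 2 / 2) := by
    field_simp
  rw [this, mul_assoc]
  gcongr

/-- Exponential majorant of the squared excess of a sub-Gaussian variable. -/
lemma exists_integrable_excess_sq_le {n : ℕ} {ξ : Fin n → Ω → ℝ} {σ : ℝ}
    (h : SubGaussianErrors μ ξ σ) {u : Fin n → ℝ} {v a : ℝ} (hv : 0 < v) (ha : 0 < a)
    (hu : σ ^ 2 * (u ⬝ᵥ u) = v) :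
    ∃ f : Ω → ℝ, Integrable f μ ∧ (∀ ω, excess a (u ⬝ᵥ fun i => ξ i ω) ^ 2 ≤ f ω) ∧
      ∫ ω, f ω ∂μ ≤ 4 * v ^ 2 / a ^ 2 * Real.exp (-(a ^ 2 / (2 * v))) := by
  -- `θ = a / v` minimizes the Chernoff exponent `θ² v / 2 - θ a`.
  have hθ : 0 < a / v := by positivity
  have h1 := h.integral_exp_dotProduct_le ((a / v) • u)
  have h2 := h.integral_exp_dotProduct_le ((-(a / v)) • u)
  simp only [smul_dotProduct, smul_eq_mul, dotProduct_smul] at h1 h2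
  refine ⟨_, (h1.1.add h2.1).const_mul (2 / (a / v) ^ 2 * Real.exp (-(a / v * a))),
    fun ω => excess_sq_le hθ a _, ?_⟩
  simp only [Pi.add_apply]
  rw [integral_const_mul, integral_add h1.1 h2.1]
  have e1 : σ ^ 2 * (a / v * (a / v * (u ⬝ᵥ u))) / 2 = a ^ 2 / (2 * v) := by
    rw [show σ ^ 2 * (a / v * (a / v * (u ⬝ᵥ u))) = (a / v) ^ 2 * (σ ^ 2 * (u ⬝ᵥ u)) by ring, hu]
    field_simp
  have e2 : σ ^ 2 * (-(a / v) * (-(a / v) * (u ⬝ᵥ u))) / 2 = a ^ 2 / (2 * v) := by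
    rw [← e1]
    ring
  rw [e1] at h1
  rw [e2] at h2
  have h3 : Real.exp (-(a / v * a)) * Real.exp (a ^ 2 / (2 * v)) =
      Real.exp (-(a ^ 2 / (2 * v))) := by
    rw [← Real.exp_add]
    congr 1
    field_simp
    ring
  calc _ ≤ 2 / (a / v) ^ 2 * Real.exp (-(a / v * a)) *
        (Real.exp (a ^ 2 / (2 * v)) + Real.exp (a ^ 2 / (2 * v))) := by
        gcongr
        exacts [h1.2, h2.2]
    _ = 4 / (a / v) ^ 2 * (Real.exp (-(a / v * a)) * Real.exp (a ^ 2 / (2 * v))) := by ring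
    _ = _ := by
        rw [h3]
        field_simp

end Concentration

/-! ### Restricted isometry and least squares -/

lemma l2norm_sq {ι : Type*} [Fintype ι] (v : ι → ℝ) : l2norm v ^ 2 = v ⬝ᵥ v := by
  rw [l2norm, EuclideanSpace.real_norm_sq_eq, dotProduct]
  simp [sq]

lemma l2norm_nonneg {ι : Type*} [Fintype ι] (v : ι → ℝ) : 0 ≤ l2norm v := norm_nonneg _

lemma notMem_supp {p : ℕ} {β : Fin p → ℝ} {i : Fin p} : i ∉ supp β ↔ β i = 0 := by
  simp [supp]

lemma mem_supp {p : ℕ} {β : Fin p → ℝ} {i : Fin p} : i ∈ supp β ↔ β i ≠ 0 := by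
  simp [supp]

lemma supp_sub_subset {p : ℕ} (a b : Fin p → ℝ) : supp (a - b) ⊆ supp a ∪ supp b := by
  intro i hi
  by_contra h
  rw [Finset.mem_union, not_or, notMem_supp, notMem_supp] at h
  exact mem_supp.1 hi (by simp [h.1, h.2])

/-- The restriction of a vector to a set of coordinates. -/
def restrict {p : ℕ} (S : Finset (Fin p)) (v : Fin p → ℝ) : Fin p → ℝ :=
  fun i => if i ∈ S then v i else 0

lemma supp_restrict_subset {p : ℕ} (S : Finset (Fin p)) (v : Fin p → ℝ) :
    supp (restrict S v) ⊆ S := by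
  intro i hi
  by_contra h
  exact mem_supp.1 hi (by simp [restrict, h])

lemma restrict_dotProduct {p : ℕ} (S : Finset (Fin p)) (v w : Fin p → ℝ) :
    restrict S v ⬝ᵥ w = ∑ i ∈ S, v i * w i := by
  simp [dotProduct, restrict, Finset.sum_ite_mem, ite_mul]

lemma restrict_dotProduct_restrict {p : ℕ} (S : Finset (Fin p)) (v : Fin p → ℝ) :
    restrict S v ⬝ᵥ restrict S v = ∑ i ∈ S, v i ^ 2 := by
  rw [restrict_dotProduct]
  exact Finset.sum_congr rfl fun i hi => by simp [restrict, hi, sq]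

section RestrictedIsometry

variable {n p k : ℕ} {X : Matrix (Fin n) (Fin p) ℝ} {δ : ℝ}

lemma RIP.abs_dotProduct_self_sub_le (h : RIP X k δ) (hn : 0 < n) {R : Finset (Fin p)}
    (hR : R.card ≤ k) {u : Fin p → ℝ} (hu : supp u ⊆ R) :
    |(X *ᵥ u) ⬝ᵥ (X *ᵥ u) - n * (u ⬝ᵥ u)| ≤ δ * n * (u ⬝ᵥ u) := by
  by_cases h0 : u = 0
  · simp [h0]
  obtain ⟨h1, h2⟩ := h.2.2 R hR u h0 fun i hi => notMem_supp.1 fun h => hi (hu h)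
  have hpos : 0 < n * (u ⬝ᵥ u) := by
    have hu : 0 < u ⬝ᵥ u := lt_of_le_of_ne (zero_le_dotProduct_self u)
      fun h => h0 (dotProduct_self_eq_zero.1 h.symm)
    positivity
  rw [l2norm_sq, l2norm_sq, le_div_iff₀ hpos] at h1
  rw [l2norm_sq, l2norm_sq, div_le_iff₀ hpos] at h2
  rw [abs_le]
  constructor <;> linarith

/-- Polarization, applied to `‖v‖ u ± ‖u‖ v`: both summands then have the same norm, which yields
the product of norms on the right without a loss in the constant. -/
lemma RIP.abs_dotProduct_sub_le (h : RIP X k δ) (hn : 0 < n) {R : Finset (Fin p)}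
    (hR : R.card ≤ k) {u v : Fin p → ℝ} (hu : supp u ⊆ R) (hv : supp v ⊆ R) :
    |(X *ᵥ u) ⬝ᵥ (X *ᵥ v) - n * (u ⬝ᵥ v)| ≤ δ * n * (√(u ⬝ᵥ u) * √(v ⬝ᵥ v)) := by
  set a := √(u ⬝ᵥ u) with ha
  set b := √(v ⬝ᵥ v) with hb
  have ha2 : a ^ 2 = u ⬝ᵥ u := Real.sq_sqrt (zero_le_dotProduct_self u)
  have hb2 : b ^ 2 = v ⬝ᵥ v := Real.sq_sqrt (zero_le_dotProduct_self v)
  rcases (Real.sqrt_nonneg (u ⬝ᵥ u)).eq_or_lt' with h0 | hapos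
  · have : u = 0 := dotProduct_self_eq_zero.1 (by rw [← ha2, ha, h0]; simp)
    simp [this, ha ▸ h0]
  rcases (Real.sqrt_nonneg (v ⬝ᵥ v)).eq_or_lt' with h0 | hbpos
  · have : v = 0 := dotProduct_self_eq_zero.1 (by rw [← hb2, hb, h0]; simp)
    simp [this, hb ▸ h0]
  rw [← ha] at hapos
  rw [← hb] at hbpos
  have hsupp (c : ℝ) : supp (b • u + c • v) ⊆ R := by
    intro i hi
    by_contra hiR
    have h1 := notMem_supp.1 fun h => hiR (hu h)
    have h2 := notMem_supp.1 fun h => hiR (hv h)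
    exact mem_supp.1 hi (by simp [h1, h2])
  have h1 := h.abs_dotProduct_self_sub_le hn hR (hsupp a)
  have h2 := h.abs_dotProduct_self_sub_le hn hR (hsupp (-a))
  simp only [Matrix.mulVec_add, Matrix.mulVec_smul, add_dotProduct, dotProduct_add,
    smul_dotProduct, dotProduct_smul, smul_eq_mul, dotProduct_comm v u,
    dotProduct_comm (X *ᵥ v) (X *ᵥ u), ← ha2, ← hb2] at h1 h2
  set q := (X *ᵥ u) ⬝ᵥ (X *ᵥ v) - n * (u ⬝ᵥ v) with hq
  rw [abs_le] at h1 h2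
  have hab : 0 < a * b := by positivity
  rw [abs_le]
  constructor
  · refine le_of_mul_le_mul_left ?_ hab
    rw [hq]
    nlinarith [h1.1, h2.2]
  · refine le_of_mul_le_mul_left ?_ hab
    rw [hq]
    nlinarith [h1.2, h2.1]

lemma dotProduct_transpose_mulVec (u : Fin p → ℝ) (w : Fin n → ℝ) :
    u ⬝ᵥ (Xᵀ *ᵥ w) = (X *ᵥ u) ⬝ᵥ w := by
  rw [Matrix.mulVec_transpose, dotProduct_comm, ← Matrix.dotProduct_mulVec, dotProduct_comm]

/-- On few coordinates, the Gram matrix is close to the identity. -/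
lemma RIP.sum_sq_sub_gram_le (h : RIP X k δ) (hn : 0 < n) {R U : Finset (Fin p)}
    (hR : R.card ≤ k) (hU : U ⊆ R) {e : Fin p → ℝ} (he : supp e ⊆ R) :
    ∑ i ∈ U, (e i - (n : ℝ)⁻¹ * (Xᵀ *ᵥ (X *ᵥ e)) i) ^ 2 ≤ δ ^ 2 * (e ⬝ᵥ e) := by
  set Δ : Fin p → ℝ := e - (n : ℝ)⁻¹ • (Xᵀ *ᵥ (X *ᵥ e)) with hΔ
  have hn' : (0 : ℝ) < n := by exact_mod_cast hn
  -- Duality: testing against `Δ` restricted to `U` gives `D ≤ δ √D ‖e‖`.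
  have h1 := h.abs_dotProduct_sub_le hn hR ((supp_restrict_subset U Δ).trans hU) he
  set D := ∑ i ∈ U, (e i - (n : ℝ)⁻¹ * (Xᵀ *ᵥ (X *ᵥ e)) i) ^ 2 with hD
  have hdd : restrict U Δ ⬝ᵥ restrict U Δ = D := restrict_dotProduct_restrict U Δ
  have hdΔ : restrict U Δ ⬝ᵥ Δ = D := by
    rw [restrict_dotProduct]
    exact Finset.sum_congr rfl fun i _ => by simp [hΔ, sq]
  have hdΔ' : restrict U Δ ⬝ᵥ Δ =
      restrict U Δ ⬝ᵥ e - (n : ℝ)⁻¹ * ((X *ᵥ restrict U Δ) ⬝ᵥ (X *ᵥ e)) := by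
    conv_lhs => rw [hΔ, dotProduct_sub, dotProduct_smul, dotProduct_transpose_mulVec, smul_eq_mul]
  rw [hdd] at h1
  set a := √D
  set c := √(e ⬝ᵥ e)
  have hD0 : 0 ≤ D := Finset.sum_nonneg fun _ _ => sq_nonneg _
  have ha : a ^ 2 = D := Real.sq_sqrt hD0
  have hc : c ^ 2 = e ⬝ᵥ e := Real.sq_sqrt (zero_le_dotProduct_self e)
  have hD1 : D ≤ δ * (a * c) := by
    refine le_of_mul_le_mul_left ?_ hn'
    have : n * D = -((X *ᵥ restrict U Δ) ⬝ᵥ (X *ᵥ e) - n * (restrict U Δ ⬝ᵥ e)) := by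
      rw [← hdΔ, hdΔ']
      field_simp
      ring
    rw [this]
    refine (neg_le_abs _).trans (h1.trans_eq (by ring))
  have hδ := h.1
  have ha0 : 0 ≤ a := Real.sqrt_nonneg _
  have hc0 : 0 ≤ c := Real.sqrt_nonneg _
  have : a ≤ δ * c := by
    rcases ha0.eq_or_lt' with h0 | h0
    · rw [h0]; positivity
    · refine le_of_mul_le_mul_left ?_ h0
      nlinarith
  rw [← ha, ← hc, ← mul_pow]
  gcongr

/-- The normal equations, from first-order variations `b + c v` of the minimizer. -/
lemma IsLeastSquaresOn.residual_dotProduct_eq_zero {y : Fin n → ℝ} {S : Finset (Fin p)}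
    {b : Fin p → ℝ} (h : IsLeastSquaresOn X y S b) {v : Fin p → ℝ} (hv : supp v ⊆ S) :
    (y - X *ᵥ b) ⬝ᵥ (X *ᵥ v) = 0 := by
  set q := (y - X *ᵥ b) ⬝ᵥ (X *ᵥ v) with hq
  set Q := (X *ᵥ v) ⬝ᵥ (X *ᵥ v) with hQ
  have hQ0 : 0 ≤ Q := zero_le_dotProduct_self _
  have key (c : ℝ) : 2 * c * q ≤ c ^ 2 * Q := by
    have hs : supp (b + c • v) ⊆ S := by
      intro i hi
      by_contra hiS
      have h1 := notMem_supp.1 fun h' => hiS (h.1 h')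
      have h2 := notMem_supp.1 fun h' => hiS (hv h')
      exact mem_supp.1 hi (by simp [h1, h2])
    have h1 := pow_le_pow_left₀ (l2norm_nonneg _) (h.2 _ hs) 2
    have h2 : y - X *ᵥ (b + c • v) = (y - X *ᵥ b) - c • (X *ᵥ v) := by
      rw [Matrix.mulVec_add, Matrix.mulVec_smul, sub_sub]
    have h3 (r w : Fin n → ℝ) :
        (r - c • w) ⬝ᵥ (r - c • w) = r ⬝ᵥ r - 2 * c * (r ⬝ᵥ w) + c ^ 2 * (w ⬝ᵥ w) := by
      simp only [sub_dotProduct, dotProduct_sub, smul_dotProduct, dotProduct_smul, smul_eq_mul,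
        dotProduct_comm w r]
      ring
    rw [l2norm_sq, l2norm_sq, h2, h3, ← hq, ← hQ] at h1
    linarith
  -- `Q + 1` in place of `Q`, which may vanish.
  have h1 := key (q / (Q + 1))
  have hQ1 : 0 < Q + 1 := by linarith
  have h2 : q ^ 2 * (2 * (Q + 1)) ≤ q ^ 2 * Q := by
    have := mul_le_mul_of_nonneg_left h1 (by positivity : 0 ≤ (Q + 1) ^ 2)
    field_simp at this
    linarith
  have h3 : q ^ 2 = 0 := by nlinarith [sq_nonneg q]
  exact pow_eq_zero_iff two_ne_zero |>.1 h3

/-- Error of the least squares estimator on a support `S`. -/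
lemma RIP.leastSquares_error_le (h : RIP X k δ) (hn : 0 < n) {S : Finset (Fin p)}
    {b β : Fin p → ℝ} {ξ : Fin n → ℝ} (hb : IsLeastSquaresOn X (X *ᵥ β + ξ) S b)
    (hR : (S ∪ supp β).card ≤ k) :
    (1 - 2 * δ ^ 2) * ((b - β) ⬝ᵥ (b - β)) ≤
      ∑ i ∈ supp β \ S, β i ^ 2 + 2 * ∑ i ∈ S, ((n : ℝ)⁻¹ * (Xᵀ *ᵥ ξ) i) ^ 2 := by
  have hn' : (0 : ℝ) < n := by exact_mod_cast hn
  set e := b - β with he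
  set g := restrict S e with hg
  have hgS : supp g ⊆ S := supp_restrict_subset S e
  have heR : supp e ⊆ S ∪ supp β :=
    (supp_sub_subset b β).trans (Finset.union_subset_union_left hb.1)
  -- The test direction is the error itself, cut to `S`. With restricted isometry this gives `‖g‖ ≤
  -- √N + δ ‖e‖`; off `S` the error is exactly `-β`.
  have horth := hb.residual_dotProduct_eq_zero hgS
  have hres : X *ᵥ β + ξ - X *ᵥ b = ξ - X *ᵥ e := by
    rw [he, Matrix.mulVec_sub]
    abel
  rw [hres, sub_dotProduct, sub_eq_zero] at horth
  set N := ∑ i ∈ S, ((n : ℝ)⁻¹ * (Xᵀ *ᵥ ξ) i) ^ 2 with hN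
  have hgg : g ⬝ᵥ g = ∑ i ∈ S, e i ^ 2 := restrict_dotProduct_restrict S e
  have hge : e ⬝ᵥ g = g ⬝ᵥ g := by
    rw [dotProduct_comm, hgg, hg, restrict_dotProduct]
    simp [sq]
  have hnoise : ξ ⬝ᵥ (X *ᵥ g) = n * ∑ i ∈ S, e i * ((n : ℝ)⁻¹ * (Xᵀ *ᵥ ξ) i) := by
    rw [dotProduct_comm, ← dotProduct_transpose_mulVec, hg, restrict_dotProduct, Finset.mul_sum]
    refine Finset.sum_congr rfl fun i _ => ?_
    field_simp
  have hCS := Finset.sum_mul_sq_le_sq_mul_sq S e (fun i => (n : ℝ)⁻¹ * (Xᵀ *ᵥ ξ) i)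
  have hrip := h.abs_dotProduct_sub_le hn hR heR (hgS.trans Finset.subset_union_left)
  rw [hge, ← horth, hnoise] at hrip
  rw [← hgg, ← hN] at hCS
  set I := ∑ i ∈ S, e i * ((n : ℝ)⁻¹ * (Xᵀ *ᵥ ξ) i)
  set G := g ⬝ᵥ g with hG
  set E := e ⬝ᵥ e with hE
  have hG0 : 0 ≤ G := zero_le_dotProduct_self g
  have hE0 : 0 ≤ E := zero_le_dotProduct_self e
  have hN0 : 0 ≤ N := Finset.sum_nonneg fun _ _ => sq_nonneg _
  have hδ := h.1
  have hI : I ≤ √G * √N := by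
    rw [← Real.sqrt_mul hG0]
    exact Real.le_sqrt_of_sq_le hCS
  have hG1 : G - I ≤ δ * (√E * √G) := by
    refine le_of_mul_le_mul_left ?_ hn'
    calc n * (G - I) = -(n * I - n * G) := by ring
      _ ≤ _ := (neg_le_abs _).trans hrip
      _ = _ := by ring
  have hsq : √G ≤ √N + δ * √E := by
    rcases (Real.sqrt_nonneg G).eq_or_lt' with h0 | h0
    · rw [h0]; positivity
    · refine le_of_mul_le_mul_left ?_ h0
      nlinarith [Real.sq_sqrt hG0]
  have hG2 : G ≤ 2 * N + 2 * δ ^ 2 * E := by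
    have h1 := pow_le_pow_left₀ (Real.sqrt_nonneg G) hsq 2
    rw [Real.sq_sqrt hG0] at h1
    nlinarith [Real.sq_sqrt hN0, Real.sq_sqrt hE0, sq_nonneg (√N - δ * √E)]
  have hsplit : E = G + ∑ i ∈ supp β \ S, β i ^ 2 := by
    have h1 : E = ∑ i, e i ^ 2 := by simp [hE, dotProduct, sq]
    rw [h1, hgg, ← Finset.sum_add_sum_compl S]
    congr 1
    have h2 : supp β \ S ⊆ Sᶜ := fun i hi => by simpa using (Finset.mem_sdiff.1 hi).2
    rw [← Finset.sum_subset h2]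
    · refine Finset.sum_congr rfl fun i hi => ?_
      have : b i = 0 := notMem_supp.1 fun h' => (Finset.mem_sdiff.1 hi).2 (hb.1 h')
      simp [he, this]
    · intro i hi hi'
      have hiS : i ∉ S := by simpa using hi
      have h3 : b i = 0 := notMem_supp.1 fun h' => hiS (hb.1 h')
      have h4 : β i = 0 := notMem_supp.1 fun h' => hi' (Finset.mem_sdiff.2 ⟨h', hiS⟩)
      simp [he, h3, h4]
  linarith

end RestrictedIsometry

/-! ### Hard thresholding -/

/-- Energy of the true coefficients missed by selecting the entries of largest modulus of a
perturbation `β + Δ + Ξ` of `β`. -/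
lemma sum_missed_sq_le {p : ℕ} {β Δ Ξ H : Fin p → ℝ} {T : Finset (Fin p)} {ε z : ℝ}
    (hH : ∀ i, H i = β i + Δ i + Ξ i) (hT : ∀ i ∈ T, ∀ j, j ∉ T → |H j| ≤ |H i|)
    (hcard : (supp β).card ≤ T.card) (hε : 0 < ε) (hz : 0 ≤ z)
    (hmin : ∀ i ∈ supp β, (1 + 3 * ε) * z ≤ |β i|) :
    ∑ i ∈ supp β \ {i ∈ T | H i ≠ 0}, β i ^ 2 ≤ 4 * ((1 + 3 * ε) / ε) ^ 2 *
      (∑ i ∈ T ∪ supp β, Δ i ^ 2 + (∑ i ∈ supp β, excess (ε * z) (Ξ i) ^ 2 +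
        ∑ i, excess ((1 + ε) * z) (Ξ i) ^ 2)) := by
  classical
  rcases isEmpty_or_nonempty (Fin p) with hp | hp
  · rw [Finset.sum_of_isEmpty, Finset.sum_of_isEmpty, Finset.sum_of_isEmpty, Finset.sum_of_isEmpty]
    simp
  have hle : ((supp β \ T : Finset (Fin p)) : Set (Fin p)).encard ≤
      ((T \ supp β : Finset (Fin p)) : Set (Fin p)).encard := by
    rw [Set.encard_coe_eq_coe_finsetCard, Set.encard_coe_eq_coe_finsetCard]
    have h1 := Finset.card_sdiff_add_card_inter (supp β) T
    have h2 := Finset.card_sdiff_add_card_inter T (supp β)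
    rw [Finset.inter_comm] at h2
    exact_mod_cast (by omega : (supp β \ T).card ≤ (T \ supp β).card)
  -- Each discarded true coefficient gets its own false selection, so the errors at the partners are
  -- counted once.
  obtain ⟨f, hf, hinj⟩ := (Finset.finite_toSet (supp β \ T)).exists_injOn_of_encard_le hle
  have hfm (i) (hi : i ∈ supp β \ T) : f i ∈ T \ supp β := by simpa using hf hi
  set κ := (1 + 3 * ε) / ε with hκ
  have hκ0 : 0 < κ := by positivity
  set ψ : Fin p → ℝ := fun j => Δ j ^ 2 + excess ((1 + ε) * z) (Ξ j) ^ 2 with hψ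
  have hψ0 (j) : 0 ≤ ψ j := by positivity
  set S' : Finset (Fin p) := {i ∈ T | H i ≠ 0}
  have key (i) (hi : i ∈ supp β \ S') : β i ^ 2 ≤ 4 * κ ^ 2 *
      ((Δ i ^ 2 + excess (ε * z) (Ξ i) ^ 2) + if i ∈ T then 0 else ψ (f i)) := by
    obtain ⟨hiβ, hiS⟩ := Finset.mem_sdiff.1 hi
    have hlow := hmin i hiβ
    have hex := abs_le_add_excess (ε * z) (Ξ i)
    have hβi : |β i| ≤ |H i| + |Δ i| + |Ξ i| := by
      have : β i = H i - Δ i - Ξ i := by rw [hH]; ring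
      rw [this]
      exact (abs_sub _ _).trans (add_le_add_left (abs_sub _ _) _)
    have hκe : κ * ε = 1 + 3 * ε := by rw [hκ]; field_simp
    -- The lower bound on `|β i|` forces `D ≥ ε z`, so `(1 + 2ε) z` is itself at most `(κ - 1) D`.
    have main (D : ℝ) (hD : |β i| ≤ (1 + 2 * ε) * z + D) : |β i| ≤ κ * D := by
      have h1 : ε * z ≤ D := by linarith
      have h2 : (1 + 2 * ε) * z ≤ (κ - 1) * (ε * z) := by
        have : (κ - 1) * (ε * z) = (κ * ε - ε) * z := by ring
        rw [this, hκe]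
        linarith
      have h3 : 0 ≤ κ - 1 := by
        have : 1 ≤ κ := by rw [hκ, le_div_iff₀ hε]; linarith
        linarith
      nlinarith [mul_le_mul_of_nonneg_left h1 h3]
    have hx0 := excess_nonneg (ε * z) (Ξ i)
    by_cases hiT : i ∈ T
    -- A coordinate in `T` is missed only if its entry vanishes; no partner is needed.
    · have hHi : H i = 0 := by
        by_contra hne
        exact hiS (Finset.mem_filter.2 ⟨hiT, hne⟩)
      rw [if_pos hiT]
      have := main (|Δ i| + excess (ε * z) (Ξ i)) (by
        rw [hHi, abs_zero] at hβi
        nlinarith [mul_nonneg hε.le hz])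
      have h2 := pow_le_pow_left₀ (abs_nonneg _) this 2
      rw [sq_abs, mul_pow] at h2
      have h3 : (|Δ i| + excess (ε * z) (Ξ i)) ^ 2 ≤
          4 * (Δ i ^ 2 + excess (ε * z) (Ξ i) ^ 2 + 0) := by
        nlinarith [sq_abs (Δ i), sq_nonneg (|Δ i| - excess (ε * z) (Ξ i)),
          sq_nonneg (excess (ε * z) (Ξ i)), sq_nonneg (Δ i)]
      nlinarith [mul_le_mul_of_nonneg_left h3 (sq_nonneg κ)]
    · rw [if_neg hiT]
      obtain ⟨hfT, hfβ⟩ := Finset.mem_sdiff.1 (hfm i (Finset.mem_sdiff.2 ⟨hiβ, hiT⟩))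
      set j := f i
      have hHij := hT j hfT i hiT
      have hHj : |H j| ≤ |Δ j| + |Ξ j| := by
        rw [hH, notMem_supp.1 hfβ, zero_add]
        exact abs_add_le _ _
      have hexj := abs_le_add_excess ((1 + ε) * z) (Ξ j)
      have := main (|Δ i| + excess (ε * z) (Ξ i) + (|Δ j| + excess ((1 + ε) * z) (Ξ j)))
        (by linarith)
      have h2 := pow_le_pow_left₀ (abs_nonneg _) this 2
      rw [sq_abs, mul_pow] at h2
      have four (a b c d : ℝ) : (a + b + (c + d)) ^ 2 ≤ 4 * (a ^ 2 + b ^ 2 + (c ^ 2 + d ^ 2)) := by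
        nlinarith [sq_nonneg (a - b), sq_nonneg (a - c), sq_nonneg (a - d), sq_nonneg (b - c),
          sq_nonneg (b - d), sq_nonneg (c - d)]
      have h3 := four |Δ i| (excess (ε * z) (Ξ i)) |Δ j| (excess ((1 + ε) * z) (Ξ j))
      rw [sq_abs, sq_abs] at h3
      calc _ ≤ _ := h2
        _ ≤ κ ^ 2 * _ := mul_le_mul_of_nonneg_left h3 (sq_nonneg κ)
        _ = _ := by rw [hψ]; ring
  have hpair : ∑ i ∈ supp β \ S', (if i ∈ T then 0 else ψ (f i)) ≤ ∑ j ∈ T \ supp β, ψ j := by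
    calc _ ≤ ∑ i ∈ supp β, (if i ∈ T then 0 else ψ (f i)) :=
          Finset.sum_le_sum_of_subset_of_nonneg Finset.sdiff_subset fun i _ _ => by
            split_ifs
            exacts [le_rfl, hψ0 _]
      _ = ∑ i ∈ supp β \ T, ψ (f i) := by
          rw [Finset.sdiff_eq_filter, Finset.sum_filter]
          exact Finset.sum_congr rfl fun i _ => by split_ifs <;> simp_all
      _ = ∑ j ∈ (supp β \ T).image f, ψ j := (Finset.sum_image hinj).symm
      _ ≤ _ := Finset.sum_le_sum_of_subset_of_nonneg
          (Finset.image_subset_iff.2 hfm) fun j _ _ => hψ0 j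
  calc _ ≤ ∑ i ∈ supp β \ S', 4 * κ ^ 2 *
        ((Δ i ^ 2 + excess (ε * z) (Ξ i) ^ 2) + if i ∈ T then 0 else ψ (f i)) :=
        Finset.sum_le_sum key
    _ = 4 * κ ^ 2 * (∑ i ∈ supp β \ S', (Δ i ^ 2 + excess (ε * z) (Ξ i) ^ 2) +
        ∑ i ∈ supp β \ S', (if i ∈ T then 0 else ψ (f i))) := by
        rw [← Finset.mul_sum, Finset.sum_add_distrib]
    _ ≤ 4 * κ ^ 2 * (∑ i ∈ supp β, (Δ i ^ 2 + excess (ε * z) (Ξ i) ^ 2) +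
        ∑ j ∈ T \ supp β, ψ j) := by
        have h1 : ∑ i ∈ supp β \ S', (Δ i ^ 2 + excess (ε * z) (Ξ i) ^ 2) ≤
            ∑ i ∈ supp β, (Δ i ^ 2 + excess (ε * z) (Ξ i) ^ 2) :=
          Finset.sum_le_sum_of_subset_of_nonneg Finset.sdiff_subset fun i _ _ => by positivity
        gcongr
    _ ≤ _ := by
        have h1 : ∑ i ∈ T ∪ supp β, Δ i ^ 2 =
            ∑ i ∈ T \ supp β, Δ i ^ 2 + ∑ i ∈ supp β, Δ i ^ 2 := by
          rw [← Finset.sdiff_union_self_eq_union, Finset.sum_union Finset.sdiff_disjoint]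
        have h2 : ∑ j ∈ T \ supp β, excess ((1 + ε) * z) (Ξ j) ^ 2 ≤
            ∑ i, excess ((1 + ε) * z) (Ξ i) ^ 2 :=
          Finset.sum_le_sum_of_subset_of_nonneg (Finset.subset_univ _) fun _ _ _ => sq_nonneg _
        rw [h1, hψ, Finset.sum_add_distrib, Finset.sum_add_distrib]
        refine mul_le_mul_of_nonneg_left ?_ (by positivity)
        linarith

/-! ### The iteration on a fixed noise vector -/

section Iteration

variable {n p s : ℕ} {X : Matrix (Fin n) (Fin p) ℝ} {ξ : Fin n → ℝ} {β : Fin p → ℝ}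
  {b : ℕ → Fin p → ℝ} {S : ℕ → Finset (Fin p)} {ε δ z : ℝ}

/-- Rescaled correlations of the columns of the design with the noise. -/
noncomputable def noiseCorr (X : Matrix (Fin n) (Fin p) ℝ) (ξ : Fin n → ℝ) (i : Fin p) : ℝ :=
  (n : ℝ)⁻¹ * (Xᵀ *ᵥ ξ) i

/-- Total squared excess of the noise correlations, over the level `ε z` on the support of `β`
and over the level `(1 + ε) z` everywhere. -/
noncomputable def excessEnergy (X : Matrix (Fin n) (Fin p) ℝ) (β : Fin p → ℝ) (ε z : ℝ)
    (ξ : Fin n → ℝ) : ℝ :=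
  ∑ i ∈ supp β, excess (ε * z) (noiseCorr X ξ i) ^ 2 +
    ∑ i, excess ((1 + ε) * z) (noiseCorr X ξ i) ^ 2

/-- Energy of the coefficients outside of the set `U`. -/
noncomputable def missedEnergy (β : Fin p → ℝ) (U : Finset (Fin p)) : ℝ := ∑ i ∈ supp β \ U, β i ^ 2

lemma excessEnergy_nonneg : 0 ≤ excessEnergy X β ε z ξ :=
  add_nonneg (Finset.sum_nonneg fun _ _ => sq_nonneg _) (Finset.sum_nonneg fun _ _ => sq_nonneg _)

lemma missedEnergy_nonneg (U : Finset (Fin p)) : 0 ≤ missedEnergy β U :=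
  Finset.sum_nonneg fun _ _ => sq_nonneg _

lemma card_mul_sq_le_missedEnergy {a : ℝ} (ha : 0 ≤ a) (hmin : ∀ i ∈ supp β, a ≤ |β i|)
    (U : Finset (Fin p)) : ((supp β \ U).card : ℝ) * a ^ 2 ≤ missedEnergy β U := by
  rw [← nsmul_eq_mul]
  refine Finset.card_nsmul_le_sum _ _ _ fun i hi => ?_
  rw [← sq_abs (β i)]
  exact pow_le_pow_left₀ ha (hmin i (Finset.mem_sdiff.1 hi).1) 2

lemma IsHTPPath.exists_selection {y : Fin n → ℝ} (h : IsHTPPath X y s b S) (t : ℕ) :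
    ∃ T : Finset (Fin p), T.card = min s p ∧
      (∀ i ∈ T, ∀ j, j ∉ T → |(b t + (n : ℝ)⁻¹ • (Xᵀ *ᵥ (y - X *ᵥ b t))) j| ≤
        |(b t + (n : ℝ)⁻¹ • (Xᵀ *ᵥ (y - X *ᵥ b t))) i|) ∧
      S (t + 1) = {i ∈ T | (b t + (n : ℝ)⁻¹ • (Xᵀ *ᵥ (y - X *ᵥ b t))) i ≠ 0} := by
  obtain ⟨w, ⟨T, hc, hT, hw⟩, hS⟩ := h.threshold t
  refine ⟨T, hc, hT, ?_⟩
  rw [hS]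
  ext i
  simp [mem_supp, hw]

lemma IsHTPPath.card_succ_le {y : Fin n → ℝ} (h : IsHTPPath X y s b S) (t : ℕ) :
    (S (t + 1)).card ≤ s := by
  obtain ⟨T, hc, -, hS⟩ := h.exists_selection t
  rw [hS]
  exact (Finset.card_filter_le _ _).trans (hc.trans_le (min_le_left _ _))

/-- False selections exceed misses by at most the slack `s - s*` in the model size. -/
lemma card_sdiff_add_card_le {U : Finset (Fin p)} (hU : U.card ≤ s) :
    (U \ supp β).card + (supp β).card ≤ s + (supp β \ U).card := by
  have h1 := Finset.card_sdiff_add_card_inter U (supp β)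
  have h2 := Finset.card_sdiff_add_card_inter (supp β) U
  rw [Finset.inter_comm] at h2
  omega

/-- One thresholding step contracts the estimation error, up to the excess of the noise. -/
lemma IsHTPPath.missedEnergy_succ_le (h : IsHTPPath X (X *ᵥ β + ξ) s b S) (hn : 0 < n)
    (hX : RIP X (3 * s) δ) (hε : 0 < ε) (hε1 : ε < 1) (hδ1 : δ < ε ^ 2) (hδ2 : δ < 0.005)
    (hs : (supp β).card ≤ s) (hz : 0 ≤ z) (hmin : ∀ i ∈ supp β, (1 + 3 * ε) * z ≤ |β i|)
    {t : ℕ} (hb : (supp (b t)).card ≤ s) :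
    missedEnergy β (S (t + 1)) ≤
      1 / 32 * ((b t - β) ⬝ᵥ (b t - β)) + 64 / ε ^ 2 * excessEnergy X β ε z ξ := by
  obtain ⟨T, hc, hT, hS⟩ := h.exists_selection t
  set H := b t + (n : ℝ)⁻¹ • (Xᵀ *ᵥ (X *ᵥ β + ξ - X *ᵥ b t)) with hH
  set e := b t - β with he
  set Δ : Fin p → ℝ := fun i => e i - (n : ℝ)⁻¹ * (Xᵀ *ᵥ (X *ᵥ e)) i with hΔ
  have hHe (i) : H i = β i + Δ i + noiseCorr X ξ i := by
    have h1 : X *ᵥ β + ξ - X *ᵥ b t = ξ - X *ᵥ e := by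
      rw [he, Matrix.mulVec_sub]
      abel
    simp only [hH, h1, hΔ, noiseCorr, Matrix.mulVec_sub, Pi.add_apply, Pi.smul_apply,
      Pi.sub_apply, smul_eq_mul]
    simp only [he, Pi.sub_apply]
    ring
  have hcard : (supp β).card ≤ T.card := by
    rw [hc]
    exact le_min hs ((Finset.card_le_univ _).trans_eq (Fintype.card_fin p))
  have h1 := sum_missed_sq_le hHe hT hcard hε hz hmin
  have hTs : T.card ≤ s := hc.trans_le (min_le_left _ _)
  -- Three supports of size at most `s`: the source of the order `3 s`.
  have hR : ((T ∪ supp β) ∪ supp (b t)).card ≤ 3 * s := by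
    have h1 := Finset.card_union_le (T ∪ supp β) (supp (b t))
    have h2 := Finset.card_union_le T (supp β)
    omega
  have hsub : supp e ⊆ (T ∪ supp β) ∪ supp (b t) :=
    (supp_sub_subset _ _).trans fun i hi => by
      simp only [Finset.mem_union] at hi ⊢
      tauto
  have h2 := hX.sum_sq_sub_gram_le hn hR Finset.subset_union_left hsub
  rw [← hS] at h1
  change missedEnergy β (S (t + 1)) ≤ _ * (_ + excessEnergy X β ε z ξ) at h1
  have hδ0 := hX.1
  -- From `δ² ≤ 0.005 ε²`, the product of both bounds on `δ`; it makes `4 κ² δ² ≤ 1/32`, with `κ =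
  -- (1 + 3ε) / ε`.
  have hδε : δ ≤ 0.071 * ε := by
    refine le_of_sq_le_sq ?_ (by positivity)
    nlinarith
  have hκδ : 4 * ((1 + 3 * ε) / ε) ^ 2 * δ ^ 2 ≤ 1 / 32 := by
    have h3 : (1 + 3 * ε) / ε * δ ≤ 0.088 := by
      rw [div_mul_eq_mul_div, div_le_iff₀ hε]
      nlinarith
    have h4 := pow_le_pow_left₀ (by positivity) h3 2
    rw [mul_pow] at h4
    linarith
  have hκ : 4 * ((1 + 3 * ε) / ε) ^ 2 ≤ 64 / ε ^ 2 := by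
    rw [div_pow, ← mul_div_assoc]
    gcongr
    nlinarith
  have hE := zero_le_dotProduct_self e
  have hW : 0 ≤ excessEnergy X β ε z ξ := excessEnergy_nonneg
  calc _ ≤ _ := h1
    _ ≤ 4 * ((1 + 3 * ε) / ε) ^ 2 * (δ ^ 2 * (e ⬝ᵥ e) + excessEnergy X β ε z ξ) := by gcongr
    _ = 4 * ((1 + 3 * ε) / ε) ^ 2 * δ ^ 2 * (e ⬝ᵥ e) +
        4 * ((1 + 3 * ε) / ε) ^ 2 * excessEnergy X β ε z ξ := by ring
    _ ≤ _ := by gcongr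

/-- After a debiasing step the estimation error is controlled by the missed coefficients. -/
lemma IsHTPPath.error_succ_le (h : IsHTPPath X (X *ᵥ β + ξ) s b S) (hn : 0 < n)
    (hX : RIP X (3 * s) δ) (hε : 0 < ε) (hε1 : ε < 1) (hδ2 : δ < 0.005)
    (hs : (supp β).card ≤ s) (hz : 0 ≤ z) (hmin : ∀ i ∈ supp β, (1 + 3 * ε) * z ≤ |β i|)
    {v L : ℝ} (hv : 0 ≤ v) (hL : 0 < L) (hzL : z ^ 2 = 2 * L * v)
    (hsL : (s : ℝ) ≤ (supp β).card + (supp β).card / L) (t : ℕ) :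
    (b (t + 1) - β) ⬝ᵥ (b (t + 1) - β) ≤ 6 * missedEnergy β (S (t + 1)) +
      3 * ∑ i ∈ supp β, noiseCorr X ξ i ^ 2 + 5 * excessEnergy X β ε z ξ +
      40 * (v * (supp β).card) := by
  have hSs := h.card_succ_le t
  set U := S (t + 1) with hU
  have hR : (U ∪ supp β).card ≤ 3 * s := (Finset.card_union_le _ _).trans (by omega)
  have hLS := hX.leastSquares_error_le hn (h.debias t) hR
  set E := (b (t + 1) - β) ⬝ᵥ (b (t + 1) - β) with hE
  have hE0 : 0 ≤ E := zero_le_dotProduct_self _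
  change _ ≤ missedEnergy β U + 2 * ∑ i ∈ U, noiseCorr X ξ i ^ 2 at hLS
  set B := missedEnergy β U with hB
  set W := excessEnergy X β ε z ξ with hW
  set k : ℝ := ((supp β).card : ℝ) with hk
  have hW0 : 0 ≤ W := excessEnergy_nonneg
  have hB0 : 0 ≤ B := missedEnergy_nonneg U
  have hN0 : 0 ≤ ∑ i ∈ supp β, noiseCorr X ξ i ^ 2 := Finset.sum_nonneg fun _ _ => sq_nonneg _
  have hsplit : ∑ i ∈ U, noiseCorr X ξ i ^ 2 ≤
      ∑ i ∈ supp β, noiseCorr X ξ i ^ 2 + ∑ i ∈ U \ supp β, noiseCorr X ξ i ^ 2 := by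
    rw [← Finset.sum_union Finset.disjoint_sdiff, Finset.union_sdiff_self_eq_union]
    exact Finset.sum_le_sum_of_subset_of_nonneg Finset.subset_union_right
      fun _ _ _ => sq_nonneg _
  have hfalse : ∑ i ∈ U \ supp β, noiseCorr X ξ i ^ 2 ≤
      (U \ supp β).card * (2 * ((1 + ε) * z) ^ 2) + 2 * W := by
    calc _ ≤ ∑ i ∈ U \ supp β, (2 * ((1 + ε) * z) ^ 2 +
          2 * excess ((1 + ε) * z) (noiseCorr X ξ i) ^ 2) := by
          refine Finset.sum_le_sum fun i _ => ?_
          have h1 := abs_le_add_excess ((1 + ε) * z) (noiseCorr X ξ i)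
          have h2 := pow_le_pow_left₀ (abs_nonneg _) h1 2
          rw [sq_abs] at h2
          nlinarith [sq_nonneg ((1 + ε) * z - excess ((1 + ε) * z) (noiseCorr X ξ i))]
      _ = (U \ supp β).card * (2 * ((1 + ε) * z) ^ 2) +
          2 * ∑ i ∈ U \ supp β, excess ((1 + ε) * z) (noiseCorr X ξ i) ^ 2 := by
          rw [Finset.sum_add_distrib, Finset.sum_const, nsmul_eq_mul, ← Finset.mul_sum]
      _ ≤ _ := by
          have h1 : ∑ i ∈ U \ supp β, excess ((1 + ε) * z) (noiseCorr X ξ i) ^ 2 ≤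
              ∑ i, excess ((1 + ε) * z) (noiseCorr X ξ i) ^ 2 :=
            Finset.sum_le_sum_of_subset_of_nonneg (Finset.subset_univ _) fun _ _ _ => sq_nonneg _
          have h2 : 0 ≤ ∑ i ∈ supp β, excess (ε * z) (noiseCorr X ξ i) ^ 2 :=
            Finset.sum_nonneg fun _ _ => sq_nonneg _
          have h3 : ∑ i, excess ((1 + ε) * z) (noiseCorr X ξ i) ^ 2 ≤ W := by
            rw [hW, excessEnergy]
            linarith
          linarith
  have hcount : ((U \ supp β).card : ℝ) ≤ k / L + (supp β \ U).card := by
    have h1 : ((U \ supp β).card : ℝ) + k ≤ s + (supp β \ U).card := by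
      rw [hk]
      exact_mod_cast card_sdiff_add_card_le hSs
    linarith
  have hm := card_mul_sq_le_missedEnergy (by positivity) hmin U
  -- The `k / L` false selections allowed by the slack cost `O(v k)`, since `z² = 2 L v`; the others
  -- are matched by misses, whose energy is already in `B`.
  have hcz : (U \ supp β).card * (2 * ((1 + ε) * z) ^ 2) ≤ 16 * (v * k) + 2 * B := by
    have hz1 : ((1 + ε) * z) ^ 2 ≤ 4 * z ^ 2 := by
      rw [mul_pow]
      have : (1 + ε) ^ 2 ≤ 4 := by nlinarith
      gcongr
    have hz2 : ((1 + ε) * z) ^ 2 ≤ ((1 + 3 * ε) * z) ^ 2 := by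
      gcongr
      linarith
    have hk0 : 0 ≤ k / L := by positivity
    have hm0 : (0 : ℝ) ≤ (supp β \ U).card := by positivity
    calc _ ≤ (k / L + (supp β \ U).card) * (2 * ((1 + ε) * z) ^ 2) := by gcongr
      _ = 2 * (k / L * ((1 + ε) * z) ^ 2) + 2 * ((supp β \ U).card * ((1 + ε) * z) ^ 2) := by ring
      _ ≤ 2 * (k / L * (4 * z ^ 2)) + 2 * ((supp β \ U).card * ((1 + 3 * ε) * z) ^ 2) := by
          gcongr
      _ ≤ 2 * (k / L * (4 * z ^ 2)) + 2 * B := by gcongr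
      _ = _ := by
          rw [hzL]
          field_simp
          ring
  have hδ0 := hX.1
  have hδsq : δ ^ 2 ≤ 0.000025 := by nlinarith
  have hvk : 0 ≤ v * k := by positivity
  have : 0.9999 * E ≤ (1 - 2 * δ ^ 2) * E := by
    gcongr
    linarith
  linarith

/-- Linear convergence of the missed energy, on the event that the noise is well behaved. -/
lemma IsHTPPath.missedEnergy_le (h : IsHTPPath X (X *ᵥ β + ξ) s b S) (hn : 0 < n)
    (hX : RIP X (3 * s) δ) (hε : 0 < ε) (hε1 : ε < 1) (hδ1 : δ < ε ^ 2) (hδ2 : δ < 0.005)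
    (hs : (supp β).card ≤ s) (hz : 0 ≤ z) (hmin : ∀ i ∈ supp β, (1 + 3 * ε) * z ≤ |β i|)
    {v L A E₀ : ℝ} (hv : 0 ≤ v) (hL : 0 < L) (hzL : z ^ 2 = 2 * L * v)
    (hsL : (s : ℝ) ≤ (supp β).card + (supp β).card / L) (hb : (supp (b 0)).card ≤ s)
    (hA : 0 ≤ A) (hN : ∑ i ∈ supp β, noiseCorr X ξ i ^ 2 ≤ A * (v * (supp β).card))
    (hW : excessEnergy X β ε z ξ ≤ v * (supp β).card)
    (hE₀ : (b 0 - β) ⬝ᵥ (b 0 - β) ≤ E₀) (t : ℕ) :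
    missedEnergy β (S (t + 1)) ≤
      Real.exp (-t) * E₀ + 2 * (A + 2 + 64 / ε ^ 2) * (v * (supp β).card) := by
  have hvk : 0 ≤ v * (supp β).card := by positivity
  have hA' : 0 ≤ A * (v * (supp β).card) := by positivity
  have hεW : 64 / ε ^ 2 * excessEnergy X β ε z ξ ≤ 64 / ε ^ 2 * (v * (supp β).card) := by gcongr
  have hε0 : 0 ≤ 64 / ε ^ 2 * (v * (supp β).card) := by positivity
  have hE0 : 0 ≤ E₀ := (zero_le_dotProduct_self _).trans hE₀
  induction t with
  | zero =>
    have h1 := h.missedEnergy_succ_le hn hX hε hε1 hδ1 hδ2 hs hz hmin hb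
    simp only [Nat.cast_zero, neg_zero, Real.exp_zero, one_mul]
    linarith
  | succ t ih =>
    have hbt : (supp (b (t + 1))).card ≤ s :=
      (Finset.card_le_card (h.debias t).1).trans (h.card_succ_le t)
    have h1 := h.missedEnergy_succ_le hn hX hε hε1 hδ1 hδ2 hs hz hmin hbt
    have h2 := h.error_succ_le hn hX hε hε1 hδ2 hs hz hmin hv hL hzL hsL t
    -- One full iteration contracts by `6/32 < 0.3 < exp (-1)`.
    have h3 : 0.3 * Real.exp (-t) ≤ Real.exp (-((t + 1 : ℕ) : ℝ)) := by
      rw [Nat.cast_add, Nat.cast_one, neg_add, Real.exp_add, mul_comm]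
      gcongr
      linarith [Real.exp_neg_one_gt_d9]
    have h4 := mul_le_mul_of_nonneg_right h3 hE0
    have h5 := mul_nonneg (Real.exp_pos (-(t : ℝ))).le hE0
    linarith

end Iteration

/-! ### Probability of well behaved noise -/

section Noise

universe u

variable {Ω : Type*} [MeasurableSpace Ω] {μ : Measure Ω} {n p : ℕ}
  {X : Matrix (Fin n) (Fin p) ℝ} {ξ : Fin n → Ω → ℝ} {σ : ℝ} {β : Fin p → ℝ}

lemma noiseCorr_eq (X : Matrix (Fin n) (Fin p) ℝ) (w : Fin n → ℝ) (j : Fin p) :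
    noiseCorr X w j = ((n : ℝ)⁻¹ • fun i => X i j) ⬝ᵥ w := by
  rw [noiseCorr, smul_dotProduct, smul_eq_mul]
  rfl

lemma measurable_noiseCorr (hξ : ∀ i, Measurable (ξ i)) (j : Fin p) :
    Measurable fun ω => noiseCorr X (fun i => ξ i ω) j := by
  simp only [noiseCorr_eq, dotProduct]
  fun_prop

/-- Restricted isometry bounds the joint variance proxy of the noise correlations on the support:
`(1 + δ) σ² / n ≤ 2 σ² / n`. -/
lemma integral_exp_dotProduct_noiseCorr_le {k : ℕ} {δ : ℝ} (hn : 0 < n)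
    (hξ : SubGaussianErrors μ ξ σ) (hX : RIP X k δ) (hk : (supp β).card ≤ k) (g : supp β → ℝ) :
    Integrable (fun ω => Real.exp
      (g ⬝ᵥ fun i : supp β => noiseCorr X (fun i => ξ i ω) i)) μ ∧
    ∫ ω, Real.exp (g ⬝ᵥ fun i : supp β => noiseCorr X (fun i => ξ i ω) i) ∂μ ≤
      Real.exp (2 * (σ ^ 2 / n) * (g ⬝ᵥ g) / 2) := by
  have hn' : (0 : ℝ) < n := by exact_mod_cast hn
  set G : Fin p → ℝ := fun i => if h : i ∈ supp β then g ⟨i, h⟩ else 0 with hG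
  have hGs : supp G ⊆ supp β := fun i hi => by
    by_contra h
    exact mem_supp.1 hi (dif_neg h)
  have hsum (F : Fin p → ℝ) : G ⬝ᵥ F = ∑ i : supp β, g i * F i := by
    have h1 : G ⬝ᵥ F = ∑ i ∈ supp β, G i * F i :=
      (Finset.sum_subset (Finset.subset_univ _) fun i _ hi => by simp [hG, hi]).symm
    rw [h1, ← Finset.sum_coe_sort (supp β)]
    refine Finset.sum_congr rfl fun i _ => ?_
    simp only [hG]
    rw [dif_pos i.2]
  have hgg : g ⬝ᵥ g = G ⬝ᵥ G := by
    rw [hsum, dotProduct]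
    refine Finset.sum_congr rfl fun i _ => ?_
    simp only [hG]
    rw [dif_pos i.2]
  have hgV (ω : Ω) : (g ⬝ᵥ fun i : supp β => noiseCorr X (fun i => ξ i ω) i) =
      ((n : ℝ)⁻¹ • (X *ᵥ G)) ⬝ᵥ fun i => ξ i ω := by
    rw [smul_dotProduct, ← dotProduct_transpose_mulVec, hsum, smul_eq_mul, Finset.mul_sum]
    refine Finset.sum_congr rfl fun i _ => ?_
    simp only [noiseCorr]
    ring
  simp only [hgV]
  obtain ⟨h1, h2⟩ := hξ.integral_exp_dotProduct_le ((n : ℝ)⁻¹ • (X *ᵥ G))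
  refine ⟨h1, h2.trans (Real.exp_le_exp.2 ?_)⟩
  have h3 := (abs_le.1 (hX.abs_dotProduct_self_sub_le hn hk hGs)).2
  have hG0 := zero_le_dotProduct_self G
  have h4 : (X *ᵥ G) ⬝ᵥ (X *ᵥ G) ≤ 2 * n * (G ⬝ᵥ G) := by
    nlinarith [mul_le_mul_of_nonneg_right hX.2.1.le (mul_nonneg hn'.le hG0)]
  rw [smul_dotProduct, dotProduct_smul, smul_eq_mul, smul_eq_mul, hgg]
  have h5 : σ ^ 2 * ((n : ℝ)⁻¹ * ((n : ℝ)⁻¹ * ((X *ᵥ G) ⬝ᵥ (X *ᵥ G)))) ≤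
      σ ^ 2 * ((n : ℝ)⁻¹ * ((n : ℝ)⁻¹ * (2 * n * (G ⬝ᵥ G)))) := by gcongr
  have h6 : σ ^ 2 * ((n : ℝ)⁻¹ * ((n : ℝ)⁻¹ * (2 * n * (G ⬝ᵥ G)))) =
      2 * (σ ^ 2 / n) * (G ⬝ᵥ G) := by field_simp
  linarith

/-- The noise correlations on the support of `β` are of the order of their standard deviation. -/
lemma exists_measure_sum_noiseCorr_sq_ge_le : ∃ A : ℝ, 0 < A ∧
    ∀ {Ω : Type u} [MeasurableSpace Ω] {μ : Measure Ω} [IsProbabilityMeasure μ] {n p k : ℕ}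
      {X : Matrix (Fin n) (Fin p) ℝ} {ξ : Fin n → Ω → ℝ} {σ δ : ℝ} {β : Fin p → ℝ},
      0 < n → 0 < σ → SubGaussianErrors μ ξ σ → RIP X k δ → (supp β).card ≤ k →
      μ {ω | A * (σ ^ 2 / n * (supp β).card) ≤
          ∑ i ∈ supp β, noiseCorr X (fun i => ξ i ω) i ^ 2} ≤
        ENNReal.ofReal (Real.exp (-(supp β).card)) := by
  obtain ⟨A, hA0, hA⟩ := exists_measure_dotProduct_self_ge_le.{u}
  refine ⟨2 * A, by positivity, ?_⟩
  intro Ω _ μ _ n p k X ξ σ δ β hn hσ hξ hX hk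
  have hn' : (0 : ℝ) < n := by exact_mod_cast hn
  have hκ : 0 < 2 * (σ ^ 2 / n) := by positivity
  have hV : Measurable fun ω (i : supp β) => noiseCorr X (fun i => ξ i ω) i :=
    measurable_pi_iff.2 fun i => measurable_noiseCorr (X := X) hξ.measurable i.1
  have key := hA (μ := μ) hκ hV fun g => integral_exp_dotProduct_noiseCorr_le hn hξ hX hk g
  simp only [Fintype.card_coe] at key
  refine le_trans (measure_mono fun ω hω => ?_) key
  have h1 : A * (2 * (σ ^ 2 / n)) * (supp β).card = 2 * A * (σ ^ 2 / n * (supp β).card) := by ring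
  rw [Set.mem_ofPred_eq] at hω ⊢
  rw [h1]
  refine hω.trans_eq ?_
  rw [← Finset.sum_coe_sort (supp β), dotProduct]
  simp only [sq]

/-- The excess of the noise correlations is negligible. -/
lemma measure_excessEnergy_ge_le [IsProbabilityMeasure μ] {ε z L : ℝ} (hn : 0 < n) (hσ : 0 < σ)
    (hX : ∀ j, l2norm (fun i => X i j) = √(n : ℝ)) (hξ : SubGaussianErrors μ ξ σ)
    (hε : 0 < ε) (hε1 : ε < 1) (hL : 4 / ε ^ 2 ≤ L) (hz : 0 < z)
    (hzL : z ^ 2 = 2 * L * (σ ^ 2 / n)) (hβ : 0 < (supp β).card)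
    (hp : (p : ℝ) * Real.exp (-L) = (supp β).card) :
    μ {ω | σ ^ 2 / n * (supp β).card ≤ excessEnergy X β ε z fun i => ξ i ω} ≤
      ENNReal.ofReal (Real.exp (-(ε ^ 2 * L))) := by
  have hn' : (0 : ℝ) < n := by exact_mod_cast hn
  set v := σ ^ 2 / (n : ℝ) with hv
  have hv0 : 0 < v := by positivity
  have hL0 : 0 < L := lt_of_lt_of_le (by positivity) hL
  have hu (j) : σ ^ 2 * (((n : ℝ)⁻¹ • fun i => X i j) ⬝ᵥ ((n : ℝ)⁻¹ • fun i => X i j)) = v := by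
    rw [smul_dotProduct, dotProduct_smul, ← l2norm_sq, hX j, Real.sq_sqrt hn'.le, smul_eq_mul,
      smul_eq_mul, hv]
    field_simp
  have hbound {c : ℝ} (hc : 0 < c) (j : Fin p) : ∃ f : Ω → ℝ, Integrable f μ ∧
      (∀ ω, excess (c * z) (noiseCorr X (fun i => ξ i ω) j) ^ 2 ≤ f ω) ∧
      ∫ ω, f ω ∂μ ≤ 2 * v / (L * c ^ 2) * Real.exp (-(c ^ 2 * L)) := by
    obtain ⟨f, h1, h2, h3⟩ := exists_integrable_excess_sq_le hξ hv0 (mul_pos hc hz) (hu j)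
    refine ⟨f, h1, fun ω => by rw [noiseCorr_eq]; exact h2 ω, h3.trans_eq ?_⟩
    rw [mul_pow, hzL]
    have e1 : 4 * v ^ 2 / (c ^ 2 * (2 * L * v)) = 2 * v / (L * c ^ 2) := by
      field_simp
      norm_num
    have e2 : c ^ 2 * (2 * L * v) / (2 * v) = c ^ 2 * L := by field_simp
    rw [e1, e2]
  choose f hf1 hf2 hf3 using hbound hε
  choose g hg1 hg2 hg3 using hbound (by positivity : 0 < 1 + ε)
  set k : ℝ := ((supp β).card : ℝ) with hk
  have hk0 : 0 < k := by rw [hk]; exact_mod_cast hβ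
  set F : Ω → ℝ := fun ω => ∑ j ∈ supp β, f j ω + ∑ j, g j ω with hF
  have hFi : Integrable F μ :=
    (integrable_finsetSum _ fun j _ => hf1 j).add (integrable_finsetSum _ fun j _ => hg1 j)
  have hWF (ω : Ω) : excessEnergy X β ε z (fun i => ξ i ω) ≤ F ω :=
    add_le_add (Finset.sum_le_sum fun j _ => hf2 j ω) (Finset.sum_le_sum fun j _ => hg2 j ω)
  have hF0 (ω : Ω) : 0 ≤ F ω := excessEnergy_nonneg.trans (hWF ω)
  have hint : ∫ ω, F ω ∂μ ≤ v * k * Real.exp (-(ε ^ 2 * L)) := by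
    rw [hF, integral_add (integrable_finsetSum _ fun j _ => hf1 j)
      (integrable_finsetSum _ fun j _ => hg1 j), integral_finsetSum _ fun j _ => hf1 j,
      integral_finsetSum _ fun j _ => hg1 j]
    have h1 : ∑ j ∈ supp β, ∫ ω, f j ω ∂μ ≤
        k * (2 * v / (L * ε ^ 2) * Real.exp (-(ε ^ 2 * L))) := by
      refine (Finset.sum_le_card_nsmul _ _ _ fun j _ => hf3 j).trans_eq ?_
      rw [nsmul_eq_mul]
    have h2 : ∑ j, ∫ ω, g j ω ∂μ ≤
        p * (2 * v / (L * (1 + ε) ^ 2) * Real.exp (-((1 + ε) ^ 2 * L))) := by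
      refine (Finset.sum_le_card_nsmul _ _ _ fun j _ => hg3 j).trans_eq ?_
      rw [nsmul_eq_mul, Finset.card_univ, Fintype.card_fin]
    have h3 : (p : ℝ) * (2 * v / (L * (1 + ε) ^ 2) * Real.exp (-((1 + ε) ^ 2 * L))) ≤
        k * (2 * v / (L * ε ^ 2) * Real.exp (-(ε ^ 2 * L))) := by
      -- The factor `exp (-L)` turns the sum over all `p` coordinates into one of size `k`.
      have h4 : Real.exp (-((1 + ε) ^ 2 * L)) ≤ Real.exp (-L) * Real.exp (-(ε ^ 2 * L)) := by
        rw [← Real.exp_add]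
        refine Real.exp_le_exp.2 ?_
        nlinarith [mul_pos hε hL0]
      have h5 : 2 * v / (L * (1 + ε) ^ 2) ≤ 2 * v / (L * ε ^ 2) := by
        gcongr
        linarith
      calc _ ≤ (p : ℝ) * (2 * v / (L * ε ^ 2) * (Real.exp (-L) * Real.exp (-(ε ^ 2 * L)))) := by
            gcongr
        _ = p * Real.exp (-L) * (2 * v / (L * ε ^ 2) * Real.exp (-(ε ^ 2 * L))) := by ring
        _ = _ := by rw [hp]
    -- Here `L ≥ 4 / ε²` is used: each of the two sums gets half of `v k`.
    have h6 : 2 * v / (L * ε ^ 2) ≤ v / 2 := by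
      rw [div_le_iff₀ (by positivity)] at hL ⊢
      nlinarith
    have h7 : k * (2 * v / (L * ε ^ 2) * Real.exp (-(ε ^ 2 * L))) ≤
        k * (v / 2 * Real.exp (-(ε ^ 2 * L))) := by gcongr
    linarith
  have hmarkov := mul_meas_ge_le_integral_of_nonneg (ae_of_all μ hF0) hFi (v * k)
  have hreal : μ.real {ω | v * k ≤ F ω} ≤ Real.exp (-(ε ^ 2 * L)) :=
    le_of_mul_le_mul_left (hmarkov.trans hint) (by positivity)
  calc _ ≤ μ {ω | v * k ≤ F ω} :=
        measure_mono fun ω (hω : v * k ≤ excessEnergy X β ε z fun i => ξ i ω) => hω.trans (hWF ω)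
    _ = ENNReal.ofReal (μ.real {ω | v * k ≤ F ω}) := (ofReal_measureReal).symm
    _ ≤ _ := ENNReal.ofReal_le_ofReal hreal

end Noise

/-! ### Support recovery -/

section Recovery

variable {n p s : ℕ} {X : Matrix (Fin n) (Fin p) ℝ} {β : Fin p → ℝ}
  {b : ℕ → Fin p → ℝ} {S : ℕ → Finset (Fin p)}

lemma card_symmDiff_eq {α : Type*} [DecidableEq α] (A B : Finset α) :
    (symmDiff A B).card = (A \ B).card + (B \ A).card :=
  Finset.card_union_of_disjoint disjoint_sdiff_sdiff

lemma IsHTPPath.card_le {y : Fin n → ℝ} (h : IsHTPPath X y s b S)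
    (hb : (supp (b 0)).card ≤ s) (t : ℕ) : (S t).card ≤ s := by
  cases t with
  | zero => rwa [h.init]
  | succ t => exact h.card_succ_le t

lemma card_symmDiff_mul_le {U : Finset (Fin p)} {L : ℝ} (hL : 0 < L) (hU : U.card ≤ s)
    (hsL : (s : ℝ) ≤ (supp β).card + (supp β).card / L) :
    ((symmDiff U (supp β)).card : ℝ) * L ≤ (supp β).card + 2 * ((supp β \ U).card * L) := by
  have h1 : ((U \ supp β).card : ℝ) + (supp β).card ≤ s + (supp β \ U).card := by
    exact_mod_cast card_sdiff_add_card_le hU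
  have h2 : ((symmDiff U (supp β)).card : ℝ) ≤ (supp β).card / L + 2 * (supp β \ U).card := by
    rw [card_symmDiff_eq, Nat.cast_add]
    linarith
  calc _ ≤ ((supp β).card / L + 2 * (supp β \ U).card) * L := by gcongr
    _ = _ := by field_simp

/-- Number of selection errors after logarithmically many iterations, on the event that the noise
is well behaved. -/
lemma IsHTPPath.card_symmDiff_mul_le {ξ : Fin n → ℝ} {ε δ z : ℝ}
    (h : IsHTPPath X (X *ᵥ β + ξ) s b S) (hn : 0 < n)
    (hX : RIP X (3 * s) δ) (hε : 0 < ε) (hε1 : ε < 1) (hδ1 : δ < ε ^ 2) (hδ2 : δ < 0.005)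
    (hs : (supp β).card ≤ s) (hz : 0 ≤ z) (hmin : ∀ i ∈ supp β, (1 + 3 * ε) * z ≤ |β i|)
    {v L A C : ℝ} (hv : 0 < v) (hL : 1 < L) (hzL : z ^ 2 = 2 * L * v)
    (hsL : (s : ℝ) ≤ (supp β).card + (supp β).card / L) (hb : (supp (b 0)).card ≤ s)
    (hA : 0 ≤ A) (hN : ∑ i ∈ supp β, noiseCorr X ξ i ^ 2 ≤ A * (v * (supp β).card))
    (hW : excessEnergy X β ε z ξ ≤ v * (supp β).card) (hC : 0 < C)
    (hinit : (b 0 - β) ⬝ᵥ (b 0 - β) ≤ C ^ 2 * L * (v * (supp β).card)) {t : ℕ}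
    (ht : Real.log ((C + 1) ^ 2 * L) ≤ t) :
    ((symmDiff (S t) (supp β)).card : ℝ) * L ≤
      (4 + 2 * (A + 2 + 64 / ε ^ 2)) * (supp β).card := by
  have hL0 : 0 < L := by linarith
  have hpos : 0 < (C + 1) ^ 2 * L := by positivity
  -- `(C + 1)² L > 1` excludes `t = 0`, where nothing has been thresholded yet. The shift costs a
  -- factor `exp 1 < 3` below.
  obtain ⟨t, rfl⟩ : ∃ u, t = u + 1 := by
    refine Nat.exists_eq_succ_of_ne_zero fun h0 => ?_
    rw [h0, Nat.cast_zero, Real.log_nonpos_iff hpos.le] at ht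
    nlinarith [mul_pos hC hL0, mul_pos (mul_pos hC hC) hL0]
  have hB := h.missedEnergy_le hn hX hε hε1 hδ1 hδ2 hs hz hmin hv.le hL0 hzL hsL hb hA hN hW
    hinit t
  set k : ℝ := ((supp β).card : ℝ) with hk
  have hk0 : 0 ≤ k := by positivity
  have hexp : Real.exp (-t) * (C ^ 2 * L) ≤ 3 := by
    have h1 : (C + 1) ^ 2 * L ≤ Real.exp t * Real.exp 1 := by
      rw [← Real.exp_add, ← Real.log_le_iff_le_exp hpos]
      exact_mod_cast ht
    have h2 : C ^ 2 * L ≤ (C + 1) ^ 2 * L := by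
      gcongr
      linarith
    have h3 : C ^ 2 * L ≤ Real.exp t * 3 :=
      (h2.trans h1).trans (by gcongr; linarith [Real.exp_one_lt_d9])
    calc _ ≤ Real.exp (-t) * (Real.exp t * 3) := by gcongr
      _ = 3 := by rw [← mul_assoc, ← Real.exp_add, neg_add_cancel, Real.exp_zero, one_mul]
  have hm := card_mul_sq_le_missedEnergy (by positivity) hmin (S (t + 1))
  set m : ℝ := ((supp β \ S (t + 1)).card : ℝ) with hm'
  have hm0 : 0 ≤ m := by positivity
  have hmL : 2 * (m * L) ≤ (3 + 2 * (A + 2 + 64 / ε ^ 2)) * k := by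
    refine le_of_mul_le_mul_right ?_ hv
    calc 2 * (m * L) * v = m * (1 * z) ^ 2 := by rw [one_mul, hzL]; ring
      _ ≤ m * ((1 + 3 * ε) * z) ^ 2 := by
          gcongr
          linarith
      _ ≤ Real.exp (-t) * (C ^ 2 * L * (v * k)) + 2 * (A + 2 + 64 / ε ^ 2) * (v * k) :=
          hm.trans hB
      _ = Real.exp (-t) * (C ^ 2 * L) * (v * k) + 2 * (A + 2 + 64 / ε ^ 2) * (v * k) := by ring
      _ ≤ 3 * (v * k) + 2 * (A + 2 + 64 / ε ^ 2) * (v * k) := by gcongr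
      _ = _ := by ring
  have h1 := HTP.card_symmDiff_mul_le hL0 (h.card_succ_le t) hsL
  linarith

end Recovery

end HTP

/-! ### Main theorem: combination of the noise events with the deterministic bound -/

theorem corollary2 (ε : ℝ) (hε0 : 0 < ε) (hε1 : ε < 1) :
    -- `K`, `C₂`, `C₃` and `r` depend on `ε` only
    ∃ K : ℝ, 0 < K ∧ ∃ C₂ : ℝ, 0 < C₂ ∧ ∃ C₃ : ℝ, 0 < C₃ ∧
    ∃ r : ℝ → ℝ, Tendsto r atTop (𝓝 0) ∧
    ∀ C₀ : ℝ, 0 < C₀ → ∀ Cinit : ℝ, 0 < Cinit → ∃ C₁ : ℝ, 0 < C₁ ∧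
    ∀ (n p sstar s smax : ℕ) (σ δ lam : ℝ) (X : Matrix (Fin n) (Fin p) ℝ)
      (Ω : Type*) [MeasurableSpace Ω] (μ : Measure Ω) [IsProbabilityMeasure μ]
      (ξ : Fin n → Ω → ℝ),
    0 < n → 1 ≤ sstar → sstar < p → 0 < σ →
    -- normalized columns
    (∀ j, HTP.l2norm (fun i => X i j) = √(n : ℝ)) →
    -- errors, restricted isometry, sample size
    HTP.SubGaussianErrors μ ξ σ →
    HTP.RIP X (3 * s) δ → δ < min (ε ^ 2) 0.005 →
    s ≤ smax → C₀ * smax * Real.log ((p : ℝ) / smax) ≤ n →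
    -- signal strength
    (1 + 3 * ε) * σ * √(2 * Real.log ((p : ℝ) / sstar) / n) ≤ lam →
    -- model size
    sstar ≤ s → (s : ℝ) ≤ sstar + sstar / Real.log ((p : ℝ) / sstar) →
    -- uniformly over the true coefficients, the (random) initial estimator `b · 0` and the
    -- resulting runs of the algorithm on the data `y = X β + ξ`
    ∀ β ∈ HTP.betaMinClass p sstar lam,
    ∀ (b : Ω → ℕ → Fin p → ℝ) (S : Ω → ℕ → Finset (Fin p)),
    (∀ᵐ ω ∂μ, HTP.l2norm (b ω 0 - β) ≤
        Cinit * σ * √(sstar * Real.log ((p : ℝ) / sstar) / n) ∧ (HTP.supp (b ω 0)).card ≤ s) →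
    (∀ᵐ ω ∂μ, HTP.IsHTPPath X (X *ᵥ β + fun i => ξ i ω) s (b ω) (S ω)) →
    ∀ t : ℕ, Real.log (C₁ ^ 2 * Real.log ((p : ℝ) / sstar)) ≤ t →
      μ {ω | K / Real.log ((p : ℝ) / sstar) ≤
            ((symmDiff (S ω t) (HTP.supp β)).card : ℝ) / sstar} ≤
          ENNReal.ofReal (Real.exp (-C₂ * sstar) + ((sstar : ℝ) / p) ^ C₃) ∧
      -- type-I and type-II errors are `o(sstar)` as `p / sstar → ∞`
      μ {ω | r ((p : ℝ) / sstar) * sstar ≤ ((S ω t \ HTP.supp β).card : ℝ) ∨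
            r ((p : ℝ) / sstar) * sstar ≤ ((HTP.supp β \ S ω t).card : ℝ)} ≤
          ENNReal.ofReal (Real.exp (-C₂ * sstar) + ((sstar : ℝ) / p) ^ C₃) := by
  obtain ⟨A, hA0, hA⟩ := HTP.exists_measure_sum_noiseCorr_sq_ge_le
  -- The deterministic constant, plus `1 + 8 / ε²`: this makes the bound strict and covers small
  -- `L`.
  set K : ℝ := 5 + 2 * (A + 2 + 64 / ε ^ 2) + 8 / ε ^ 2 with hK
  have hK0 : 0 < K := by positivity
  refine ⟨K, hK0, 1, one_pos, ε ^ 2, by positivity, fun x => K / Real.log x,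
    Real.tendsto_log_atTop.const_div_atTop K, fun C₀ _ Cinit hCinit =>
    ⟨Cinit + 1, by positivity, ?_⟩⟩
  intro n p sstar s smax σ δ lam X Ω _ μ _ ξ hn hk1 hkp hσ hcol hξ hX hδ _ _ hlam hks hsL β hβ b S
    hinit hpath t ht
  obtain ⟨rfl, hmin⟩ := hβ
  have hn' : (0 : ℝ) < n := by exact_mod_cast hn
  have hk0 : (0 : ℝ) < (HTP.supp β).card := by exact_mod_cast hk1
  have hp0 : (0 : ℝ) < p := hk0.trans (by exact_mod_cast hkp)
  set L := Real.log ((p : ℝ) / (HTP.supp β).card) with hL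
  have hL0 : 0 < L := Real.log_pos ((one_lt_div hk0).2 (by exact_mod_cast hkp))
  obtain ⟨hδ1, hδ2⟩ := lt_min_iff.1 hδ
  set k : ℝ := ((HTP.supp β).card : ℝ) with hk
  have hmain : μ {ω | K / L ≤ ((symmDiff (S ω t) (HTP.supp β)).card : ℝ) / k} ≤
      ENNReal.ofReal (Real.exp (-1 * k) + (k / p) ^ ε ^ 2) := by
    have hK1 (c : ℝ) : K / L ≤ c / k ↔ K * k ≤ c * L := div_le_div_iff₀ hL0 hk0
    simp only [hK1]
    -- For `L < 4 / ε²` the bad event is null: the errors times `L` are at most `k + 2 k L`, below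
    -- `K k`.
    rcases lt_or_ge L (4 / ε ^ 2) with hsmall | hlarge
    · refine le_trans (le_of_eq (measure_eq_zero_iff_ae_notMem.2 ?_)) zero_le
      filter_upwards [hinit, hpath] with ω h1 h2 h3
      have h4 := HTP.card_symmDiff_mul_le hL0 (h2.card_le h1.2 t) hsL
      have h5 : ((HTP.supp β \ S ω t).card : ℝ) ≤ k := by
        rw [hk]
        exact_mod_cast Finset.card_le_card Finset.sdiff_subset
      have h6 : ((HTP.supp β \ S ω t).card : ℝ) * L ≤ k * (4 / ε ^ 2) := by gcongr
      have h7 : 0 < (4 + 2 * (A + 2 + 64 / ε ^ 2)) * k := by positivity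
      have h8 : K * k = k + (4 + 2 * (A + 2 + 64 / ε ^ 2)) * k + 2 * (k * (4 / ε ^ 2)) := by
        rw [hK]
        ring
      linarith
    · have hL1 : 1 < L := by
        refine lt_of_lt_of_le ?_ hlarge
        rw [lt_div_iff₀ (by positivity)]
        nlinarith
      set v := σ ^ 2 / (n : ℝ) with hv
      have hv0 : 0 < v := by positivity
      set z := σ * √(2 * L / n) with hz
      have hz0 : 0 < z := by positivity
      have hzL : z ^ 2 = 2 * L * v := by
        rw [hz, mul_pow, Real.sq_sqrt (by positivity), hv]
        field_simp
      have hmin' (i) (hi : i ∈ HTP.supp β) : (1 + 3 * ε) * z ≤ |β i| := by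
        rw [hz, ← mul_assoc]
        exact hlam.trans (hmin i hi)
      have hexpL : Real.exp (-L) = k / p := by
        rw [hL, Real.exp_neg, Real.exp_log (by positivity), inv_div]
      have hpL : (p : ℝ) * Real.exp (-L) = k := by
        rw [hexpL]
        field_simp
      have hN := hA (μ := μ) hn hσ hξ hX (β := β) (by omega)
      have hW := HTP.measure_excessEnergy_ge_le hn hσ hcol hξ hε0 hε1 hlarge hz0 hzL hk1 hpL
      have hrpow : (k / p) ^ ε ^ 2 = Real.exp (-(ε ^ 2 * L)) := by
        rw [← hexpL, ← Real.exp_mul]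
        congr 1
        ring
      rw [hrpow, neg_one_mul, ENNReal.ofReal_add (Real.exp_pos _).le (Real.exp_pos _).le]
      refine le_trans ?_ ((measure_union_le _ _).trans (add_le_add hN hW))
      refine measure_mono_ae ?_
      filter_upwards [hinit, hpath] with ω h1 h2 h3
      by_contra hnot
      replace hnot := not_or.1 hnot
      have hNω : ∑ i ∈ HTP.supp β, HTP.noiseCorr X (fun i => ξ i ω) i ^ 2 ≤ A * (v * k) :=
        le_of_not_ge hnot.1
      have hWω : (HTP.excessEnergy X β ε z fun i => ξ i ω) ≤ v * k := le_of_not_ge hnot.2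
      have h4 : (b ω 0 - β) ⬝ᵥ (b ω 0 - β) ≤ Cinit ^ 2 * L * (v * k) := by
        rw [← HTP.l2norm_sq]
        refine (pow_le_pow_left₀ (HTP.l2norm_nonneg _) h1.1 2).trans_eq ?_
        rw [mul_pow, mul_pow, Real.sq_sqrt (by positivity), hv]
        field_simp
      have h5 := h2.card_symmDiff_mul_le hn hX hε0 hε1 hδ1 hδ2 hks hz0.le hmin' hv0 hL1 hzL hsL
        h1.2 hA0.le hNω hWω hCinit h4 ht
      have h6 : K * k ≤ _ := h3
      have h7 : 0 < (1 + 8 / ε ^ 2) * k := by positivity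
      have h8 : K * k = (4 + 2 * (A + 2 + 64 / ε ^ 2)) * k + (1 + 8 / ε ^ 2) * k := by
        rw [hK]
        ring
      linarith
  refine ⟨hmain, (measure_mono fun ω hω => ?_).trans hmain⟩
  have hsymm : ((symmDiff (S ω t) (HTP.supp β)).card : ℝ) =
      (S ω t \ HTP.supp β).card + (HTP.supp β \ S ω t).card := by
    rw [HTP.card_symmDiff_eq, Nat.cast_add]
  rw [Set.mem_ofPred_eq, le_div_iff₀ hk0, hsymm]
  have h1 : (0 : ℝ) ≤ (S ω t \ HTP.supp β).card := by positivity
  have h2 : (0 : ℝ) ≤ (HTP.supp β \ S ω t).card := by positivity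
  rcases hω with h | h
  · exact h.trans (by linarith)
  · exact h.trans (by linarith)
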